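/- Let $K$ be a finite extension of $\mathbb{Q}_p$ with ring of integers $\mathcal{O}_K$, uniformiser $\pi$, and absolute value $|\cdot|$ (in any normalisation). **Models and transformations.** Let $n\in\{2,3,4\}$. A genus one model $\Phi$ of degree $n$ over a commutative ring $R$, and a transformation $g$ over $R$ acting on such models, are as follows. * $n=2$: a pair $(P,Q)$ of binary forms over $R$ of degrees $2$ and $4$, defining the curve $\mathcal{C}_\Phi: y^2+P(x_1,x_2)y=Q(x_1,x_2)$ in $\mathbb{P}(1,1,2)$. A transformation is $g=[\mu,r,N]$ with $\mu\in R^\times$, $r\in R^3$, $N\in\mathrm{GL}_2(R)$; it replaces $(P,Q)$ by $(\mu(P+2\rho),\ \mu^2(Q-\rho P-\rho^2))$, where $\rho=r_0x_1^2+r_1x_1x_2+r_2x_2^2$, and then substitutes $x_j\leftarrow\sum_i n_{ij}x_i$. Put $\det g=\mu\det N$. * $n=3$: a ternary cubic $U$, with $\mathcal{C}_\Phi=\{U=0\}\subset\mathbb{P}^2$. A transformation is $g=[\mu,N]$ with $\mu\in R^\times$, $N\in\mathrm{GL}_3(R)$; it multiplies $U$ by $\mu$ and then substitutes $x_j\leftarrow\sum_i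 n_{ij}x_i$. Put $\det g=\mu\det N$. * $n=4$: a pair $(Q_1,Q_2)$ of quadratic forms in $4$ variables, with $\mathcal{C}_\Phi=\{Q_1=Q_2=0\}\subset\mathbb{P}^3$. A transformation is $g=[M,N]$ with $M\in\mathrm{GL}_2(R)$, $N\in\mathrm{GL}_4(R)$; it makes $Q_i\leftarrow\sum_j m_{ij}Q_j$ and then substitutes $x_j\leftarrow\sum_i n_{ij}x_i$. Put $\det g=\det M\det N$. Models over $R$ are *$R$-equivalent* if some transformation over $R$ takes one to the other. A transformation $g$ over $K$ is *integral* if it is a transformation over $\mathcal{O}_K$ (so $\mu\in\mathcal{O}_K^\times$, $r\in\mathcal{O}_K^3$, and the matrices lie in $\mathrm{GL}(\mathcal{O}_K)$); it is *diagonal* if $r=0$ and $N$ is diagonal ($n=2$), $N$ is diagonal ($n=3$), $M$ and $N$ are diagonal ($n=4$). **The forms $F_n,G_n$** of degree $2n$ attached to a model over $K$ (subscripts on $g,h,U,H$ denote partial derivatives). * $n=2$: with $P=lx_1^2+mx_1x_2+nx_2^2$ and $c$ the coefficient of $x_1^2x_2^2$ in $Q$, put $b_2=m^2+4(c-ln)$,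 $g=\tfrac14P^2+Q$, $h=\tfrac13(g_{12}^2-g_{11}g_{22})$; then $F_2=P^2+4Q$ and $G_2=\tfrac13(h-b_2g)$. * $n=3$: let $U=ax_1^3+bx_2^3+cx_3^3+fx_2^2x_3+gx_3^2x_1+hx_1^2x_2+ix_2x_3^2+jx_3x_1^2+kx_1x_2^2+mx_1x_2x_3$, $b_2=m^2-4(fj+gk+hi)$, $H=-\tfrac12\det(U_{ij})$, and let $\Theta$ be $\tfrac13$ times the determinant of the $4\times4$ matrix obtained from $(U_{ij})$ by adding $(H_1,H_2,H_3)$ as last row and last column, with corner entry $0$. Put $Z=\tfrac14(H+b_2U)$; then $F_3=Z^2$ and $G_3=\tfrac1{192}(\Theta-16b_2Z^2-12b_2^2ZU+b_2^3U^2)$. * $n=4$: let $A,B$ be the matrices of second partial derivatives of $Q_1,Q_2$, and let $\sum_{r\le s}a^*_{rs}x_rx_s$, $\sum_{r\le s}b^*_{rs}x_rx_s$ be the quadratic forms whose matrices of second partial derivatives are $\operatorname{adj}A$, $\operatorname{adj}B$. Put $$T_1=\sum_{i,j}\sum_{r\le s}b^*_{rs}(A_{ij}A_{rs}-A_{is}A_{jr})x_ix_j,\qquad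 T_2=\sum_{i,j}\sum_{r\le s}a^*_{rs}(B_{ij}B_{rs}-B_{is}B_{jr})x_ix_j.$$ For $\Gamma=\sum_{i\le j}c_{ij}x_ix_j$ put $\mathrm{pf}(\Gamma)=c_{12}c_{34}+c_{13}c_{24}+c_{14}c_{23}$ and define $\mathrm{rd}(\Gamma)$ by $\det(\partial^2\Gamma/\partial x_i\partial x_j)=\mathrm{pf}(\Gamma)^2+4\,\mathrm{rd}(\Gamma)$. Then $F_4=F_2(T_1,-T_2)$ and $G_4=G_2(T_1,-T_2)$, where $F_2,G_2$ are those of the degree $2$ model $(\mathrm{pf}(xQ_1+zQ_2),\mathrm{rd}(xQ_1+zQ_2))$. **Tamagawa distances.** For a model $\Phi$ over $K$ let $A(\Phi)$ be the set of all $\alpha\in\mathbb{R}$ with $$\frac{\max(|F_n(\mathbf{x})|,|G_n(\mathbf{x})|)}{\max(|x_1|,\dots,|x_n|)^{2n}}=|\pi|^{2\alpha}$$ for some $P\in\mathcal{C}_\Phi(K)$, where $P=(x_1:x_2:y)$ or $P=(x_1:\dots:x_n)$. **Theorem.** Let $n\in\{2,3,4\}$. (a) Let $\Phi$ and $\Phi'$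 be genus one models of degree $n$ over $\mathcal{O}_K$ with $\Phi'=g\Phi$ for some transformation $g=[\mu,r,N]$, $[\mu,N]$ or $[M,N]$ over $K$. Let $P\in\mathcal{C}_\Phi(K)$, say $P=(x_1:x_2:y)$ or $(x_1:\dots:x_n)$, and $P'\in\mathcal{C}_{\Phi'}(K)$, say $P'=(x_1':x_2':y')$ or $(x_1':\dots:x_n')$, with $x_j=\sum_i n_{ij}x_i'$ where $N=(n_{ij})$. If either (i) $g$ is integral, or (ii) $\det g\in\mathcal{O}_K^\times$ and $g$ is diagonal, then $$\max(|F_n'(\mathbf{x}')|,|G_n'(\mathbf{x}')|)=|\det N|^{-2}\max(|F_n(\mathbf{x})|,|G_n(\mathbf{x})|),$$ where $F_n',G_n'$ are the forms attached to $\Phi'$. (b) If $\Phi$ and $\Phi'$ are $\mathcal{O}_K$-equivalent genus one models of degree $n$ over $\mathcal{O}_K$, then $A(\Phi)=A(\Phi')$. -/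

import Mathlib

open MvPolynomial

noncomputable section

namespace GenusOne

/-! ### Linear substitutions -/

/-- The substitution `x_j ← ∑ i, n_ij x_i` applied to a polynomial. -/
def linSubst {R : Type*} [CommRing R] {n : ℕ} (N : Matrix (Fin n) (Fin n) R)
    (f : MvPolynomial (Fin n) R) : MvPolynomial (Fin n) R :=
  aeval (fun j => ∑ i, C (N i j) * X i) f

theorem linSubst_isHomogeneous {R : Type*} [CommRing R] {n d : ℕ}
    (N : Matrix (Fin n) (Fin n) R) {f : MvPolynomial (Fin n) R} (hf : f.IsHomogeneous d) :
    (linSubst N f).IsHomogeneous d := by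
  have h := hf.aeval (fun j => ∑ i, C (N i j) * X i : Fin n → MvPolynomial (Fin n) R)
    (n := 1) (fun j => IsHomogeneous.sum _ _ _ fun i _ => isHomogeneous_C_mul_X _ _)
  simpa [linSubst] using h

/-! ### Genus one models -/

/-- A genus one model of degree 2 over `R`: the generalised binary quartic
`y² + P(x₁, x₂) y = Q(x₁, x₂)`. -/
structure Model2 (R : Type*) [CommRing R] where
  P : MvPolynomial (Fin 2) R
  Q : MvPolynomial (Fin 2) R
  hP : P.IsHomogeneous 2
  hQ : Q.IsHomogeneous 4

/-- A genus one model of degree 3 over `R`: a ternary cubic. -/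
structure Model3 (R : Type*) [CommRing R] where
  U : MvPolynomial (Fin 3) R
  hU : U.IsHomogeneous 3

/-- A genus one model of degree 4 over `R`: a quadric intersection, `Q 0 = Q 1 = 0`. -/
structure Model4 (R : Type*) [CommRing R] where
  Q : Fin 2 → MvPolynomial (Fin 4) R
  hQ : ∀ i, (Q i).IsHomogeneous 2

/-- Base change of a model along a ring homomorphism. -/
def Model2.map {R S : Type*} [CommRing R] [CommRing S] (φ : R →+* S) (Φ : Model2 R) :
    Model2 S where
  P := MvPolynomial.map φ Φ.P
  Q := MvPolynomial.map φ Φ.Q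
  hP := Φ.hP.map φ
  hQ := Φ.hQ.map φ

/-- See `Model2.map`. -/
def Model3.map {R S : Type*} [CommRing R] [CommRing S] (φ : R →+* S) (Φ : Model3 R) :
    Model3 S where
  U := MvPolynomial.map φ Φ.U
  hU := Φ.hU.map φ

/-- See `Model2.map`. -/
def Model4.map {R S : Type*} [CommRing R] [CommRing S] (φ : R →+* S) (Φ : Model4 R) :
    Model4 S where
  Q := fun i => MvPolynomial.map φ (Φ.Q i)
  hQ := fun i => (Φ.hQ i).map φ

/-! ### Transformations of genus one models -/

/-- The transformations `[μ, r, N]` of models of degree 2. -/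
structure Trans2 (R : Type*) [CommRing R] where
  μ : Rˣ
  r : Fin 3 → R
  N : Matrix.GeneralLinearGroup (Fin 2) R

/-- The transformations `[μ, N]` of models of degree 3. -/
structure Trans3 (R : Type*) [CommRing R] where
  μ : Rˣ
  N : Matrix.GeneralLinearGroup (Fin 3) R

/-- The transformations `[M, N]` of models of degree 4. -/
structure Trans4 (R : Type*) [CommRing R] where
  M : Matrix.GeneralLinearGroup (Fin 2) R
  N : Matrix.GeneralLinearGroup (Fin 4) R

namespace Trans2
variable {R S : Type*} [CommRing R] [CommRing S]

def map (φ : R →+* S) (g : Trans2 R) : Trans2 S where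
  μ := Units.map φ g.μ
  r := fun i => φ (g.r i)
  N := Matrix.GeneralLinearGroup.map φ g.N

/-- `det [μ, r, N] = μ det N`. -/
def det (g : Trans2 R) : R := g.μ * (g.N : Matrix (Fin 2) (Fin 2) R).det

/-- The quadratic form `r₀ x₁² + r₁ x₁ x₂ + r₂ x₂²`. -/
def rForm (g : Trans2 R) : MvPolynomial (Fin 2) R :=
  C (g.r 0) * X 0 ^ 2 + C (g.r 1) * (X 0 * X 1) + C (g.r 2) * X 1 ^ 2

theorem rForm_isHomogeneous (g : Trans2 R) : g.rForm.IsHomogeneous 2 := by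
  have h01 : (X 0 * X 1 : MvPolynomial (Fin 2) R).IsHomogeneous (1 + 1) :=
    (isHomogeneous_X R 0).mul (isHomogeneous_X R 1)
  exact ((isHomogeneous_C_mul_X_pow _ _ _).add (h01.C_mul _)).add
    (isHomogeneous_C_mul_X_pow _ _ _)

/-- The action on models of degree 2: substitute `y ← μ⁻¹ y + r₀ x₁² + r₁ x₁ x₂ + r₂ x₂²` in
`y² + P y = Q` and multiply through by `μ²`, which gives
`y² + μ (P + 2 r) y = μ² (Q - r P - r²)`; then substitute `x_j ← ∑ i, n_ij x_i`. -/
def act (g : Trans2 R) (Φ : Model2 R) : Model2 R where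
  P := linSubst g.N.1 (C (g.μ : R) * (Φ.P + C 2 * g.rForm))
  Q := linSubst g.N.1 (C ((g.μ : R) ^ 2) * (Φ.Q - g.rForm * Φ.P - g.rForm ^ 2))
  hP := linSubst_isHomogeneous _ ((Φ.hP.add (g.rForm_isHomogeneous.C_mul _)).C_mul _)
  hQ := linSubst_isHomogeneous _
    (((Φ.hQ.sub (g.rForm_isHomogeneous.mul Φ.hP)).sub
      (g.rForm_isHomogeneous.pow 2)).C_mul _)

/-- `g` is diagonal: `r = 0` and `N` is diagonal. -/
def IsDiagonal (g : Trans2 R) : Prop :=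
  g.r = 0 ∧ (g.N : Matrix (Fin 2) (Fin 2) R).IsDiag

end Trans2

namespace Trans3
variable {R S : Type*} [CommRing R] [CommRing S]

def map (φ : R →+* S) (g : Trans3 R) : Trans3 S where
  μ := Units.map φ g.μ
  N := Matrix.GeneralLinearGroup.map φ g.N

/-- `det [μ, N] = μ det N`. -/
def det (g : Trans3 R) : R := g.μ * (g.N : Matrix (Fin 3) (Fin 3) R).det

/-- The action on ternary cubics: multiply by `μ`, then substitute `x_j ← ∑ i, n_ij x_i`. -/
def act (g : Trans3 R) (Φ : Model3 R) : Model3 R where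
  U := linSubst g.N.1 (C (g.μ : R) * Φ.U)
  hU := linSubst_isHomogeneous _ (Φ.hU.C_mul _)

/-- `g` is diagonal: `N` is diagonal. -/
def IsDiagonal (g : Trans3 R) : Prop := (g.N : Matrix (Fin 3) (Fin 3) R).IsDiag

end Trans3

namespace Trans4
variable {R S : Type*} [CommRing R] [CommRing S]

def map (φ : R →+* S) (g : Trans4 R) : Trans4 S where
  M := Matrix.GeneralLinearGroup.map φ g.M
  N := Matrix.GeneralLinearGroup.map φ g.N

/-- `det [M, N] = det M det N`. -/
def det (g : Trans4 R) : R :=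
  (g.M : Matrix (Fin 2) (Fin 2) R).det * (g.N : Matrix (Fin 4) (Fin 4) R).det

/-- The action on quadric intersections: `Q_i ← ∑ j, m_ij Q_j`, then `x_j ← ∑ i, n_ij x_i`. -/
def act (g : Trans4 R) (Φ : Model4 R) : Model4 R where
  Q := fun i => linSubst g.N.1 (∑ j, C (g.M.1 i j) * Φ.Q j)
  hQ := fun _ => linSubst_isHomogeneous _
    (IsHomogeneous.sum _ _ _ fun j _ => (Φ.hQ j).C_mul _)

/-- `g` is diagonal: `M` and `N` are diagonal. -/
def IsDiagonal (g : Trans4 R) : Prop :=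
  (g.M : Matrix (Fin 2) (Fin 2) R).IsDiag ∧ (g.N : Matrix (Fin 4) (Fin 4) R).IsDiag

end Trans4

/-- `R`-equivalence: `Φ' = g Φ` for some transformation `g` over `R`. -/
def Model2.Equivalent {R : Type*} [CommRing R] (Φ Φ' : Model2 R) : Prop :=
  ∃ g : Trans2 R, Φ' = g.act Φ

/-- See `Model2.Equivalent`. -/
def Model3.Equivalent {R : Type*} [CommRing R] (Φ Φ' : Model3 R) : Prop :=
  ∃ g : Trans3 R, Φ' = g.act Φ

/-- See `Model2.Equivalent`. -/
def Model4.Equivalent {R : Type*} [CommRing R] (Φ Φ' : Model4 R) : Prop :=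
  ∃ g : Trans4 R, Φ' = g.act Φ

/-! ### The forms `F_n` and `G_n` -/

section Degree2
variable {R : Type*} [CommRing R]

/-- The coefficient of `x₁ ^ i * x₂ ^ j`. -/
def coeff2 (f : MvPolynomial (Fin 2) R) (i j : ℕ) : R :=
  coeff (Finsupp.single 0 i + Finsupp.single 1 j) f

/-- `F₂ = P² + 4 Q`. -/
def F2 (P Q : MvPolynomial (Fin 2) R) : MvPolynomial (Fin 2) R := P ^ 2 + C 4 * Q

/-- `G₂ = (h - b₂ g) / 3`, where `g = P² / 4 + Q`, `h = (g₁₂² - g₁₁ g₂₂) / 3` and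
`b₂ = m² + 4 (c - l n)`, written out in terms of the coefficients of
`P = l x₁² + m x₁ x₂ + n x₂²` and `Q = a x₁⁴ + b x₁³ x₂ + c x₁² x₂² + d x₁ x₂³ + e x₂⁴`. -/
def G2 (P Q : MvPolynomial (Fin 2) R) : MvPolynomial (Fin 2) R :=
  let l := coeff2 P 2 0
  let m := coeff2 P 1 1
  let n := coeff2 P 0 2
  let a := coeff2 Q 4 0
  let b := coeff2 Q 3 1
  let c := coeff2 Q 2 2
  let d := coeff2 Q 1 3
  let e := coeff2 Q 0 4
  C (-l ^ 2 * c + l * m * b - m ^ 2 * a - 4 * a * c + b ^ 2) * X 0 ^ 4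
  + C (-2 * l ^ 2 * d + 2 * l * n * b - 4 * m * n * a - 8 * a * d) * X 0 ^ 3 * X 1
  + C (-4 * l ^ 2 * e - l * m * d + 2 * l * n * c - m * n * b - 4 * n ^ 2 * a - 16 * a * e
      - 2 * b * d) * X 0 ^ 2 * X 1 ^ 2
  + C (-4 * l * m * e + 2 * l * n * d - 2 * n ^ 2 * b - 8 * b * e) * X 0 * X 1 ^ 3
  + C (-m ^ 2 * e + m * n * d - n ^ 2 * c - 4 * c * e + d ^ 2) * X 1 ^ 4

end Degree2

/-- The matrix of second partial derivatives. -/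
def hessianMatrix {R : Type*} [CommRing R] {n : ℕ} (f : MvPolynomial (Fin n) R) :
    Matrix (Fin n) (Fin n) (MvPolynomial (Fin n) R) :=
  Matrix.of fun i j => pderiv i (pderiv j f)

section Degree3
-- The denominators below make sense over a field of characteristic different from 2 and 3.
variable {K : Type*} [Field K]

/-- The coefficient of `x₁ ^ i * x₂ ^ j * x₃ ^ k`. -/
def coeff3 (f : MvPolynomial (Fin 3) K) (i j k : ℕ) : K :=
  coeff (Finsupp.single 0 i + Finsupp.single 1 j + Finsupp.single 2 k) f

/-- `b₂ = a₁² + 4 a₂` with `a₁ = m`, `a₂ = -(f j + g k + h i)`, for the cubic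
`a x₁³ + b x₂³ + c x₃³ + f x₂² x₃ + g x₃² x₁ + h x₁² x₂ + i x₂ x₃² + j x₃ x₁² + k x₁ x₂²
  + m x₁ x₂ x₃`. -/
def b2Cubic (U : MvPolynomial (Fin 3) K) : K :=
  let f := coeff3 U 0 2 1
  let g := coeff3 U 1 0 2
  let h := coeff3 U 2 1 0
  let i := coeff3 U 0 1 2
  let j := coeff3 U 2 0 1
  let k := coeff3 U 1 2 0
  let m := coeff3 U 1 1 1
  m ^ 2 + 4 * (-(f * j + g * k + h * i))

/-- The Hessian `H = -(1/2) det (U_ij)`. -/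
def hessianCubic (U : MvPolynomial (Fin 3) K) : MvPolynomial (Fin 3) K :=
  C (-(1 / 2)) * (hessianMatrix U).det

/-- `Θ`, which is `1/3` times the determinant of the matrix `(U_ij)` bordered by the partial
derivatives of `H`, with `0` in the corner. -/
def thetaCubic (U : MvPolynomial (Fin 3) K) : MvPolynomial (Fin 3) K :=
  let H := hessianCubic U
  let V := hessianMatrix U
  C (1 / 3) * Matrix.det
    !![V 0 0, V 0 1, V 0 2, pderiv 0 H;
       V 1 0, V 1 1, V 1 2, pderiv 1 H;
       V 2 0, V 2 1, V 2 2, pderiv 2 H;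
       pderiv 0 H, pderiv 1 H, pderiv 2 H, 0]

/-- `Z = (H + b₂ U) / 4`. -/
def ZCubic (U : MvPolynomial (Fin 3) K) : MvPolynomial (Fin 3) K :=
  C (1 / 4) * (hessianCubic U + C (b2Cubic U) * U)

/-- `F₃ = Z²`. -/
def F3 (U : MvPolynomial (Fin 3) K) : MvPolynomial (Fin 3) K := ZCubic U ^ 2

/-- `G₃ = (Θ - 16 b₂ Z² - 12 b₂² Z U + b₂³ U²) / 192`. -/
def G3 (U : MvPolynomial (Fin 3) K) : MvPolynomial (Fin 3) K :=
  C (1 / 192) * (thetaCubic U - C (16 * b2Cubic U) * ZCubic U ^ 2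
    - C (12 * b2Cubic U ^ 2) * ZCubic U * U + C (b2Cubic U ^ 3) * U ^ 2)

end Degree3

section Degree4
-- The denominators below make sense over a field of characteristic different from 2.
variable {K : Type*} [Field K]

/-- The matrix of second partial derivatives of a quadratic form, as a matrix of scalars. -/
def gramMatrix (q : MvPolynomial (Fin 4) K) : Matrix (Fin 4) (Fin 4) K :=
  Matrix.of fun i j => constantCoeff (hessianMatrix q i j)

/-- For a quadric with matrix `A` of second partial derivatives, the coefficient of `x_r x_s`
(`r ≤ s`) in the quadric whose matrix of second partial derivatives is `adj A`. -/
def dualCoeff (A : Matrix (Fin 4) (Fin 4) K) (r s : Fin 4) : K :=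
  if r = s then A.adjugate r s / 2 else A.adjugate r s

/-- `∑ i j, ∑ r ≤ s, b*_rs (A_ij A_rs - A_is A_jr) x_i x_j`. -/
def covT (A B : Matrix (Fin 4) (Fin 4) K) : MvPolynomial (Fin 4) K :=
  ∑ i, ∑ j, C (∑ r, ∑ s, if r ≤ s then
    dualCoeff B r s * (A i j * A r s - A i s * A j r) else 0) * (X i * X j)

def T1 (Q : Fin 2 → MvPolynomial (Fin 4) K) : MvPolynomial (Fin 4) K :=
  covT (gramMatrix (Q 0)) (gramMatrix (Q 1))

def T2 (Q : Fin 2 → MvPolynomial (Fin 4) K) : MvPolynomial (Fin 4) K :=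
  covT (gramMatrix (Q 1)) (gramMatrix (Q 0))

/-- The matrix of second partial derivatives of `x Q₁ + z Q₂`, over `K[x, z]`. -/
def pencil (Q : Fin 2 → MvPolynomial (Fin 4) K) :
    Matrix (Fin 4) (Fin 4) (MvPolynomial (Fin 2) K) :=
  Matrix.of fun i j =>
    C (gramMatrix (Q 0) i j) * X 0 + C (gramMatrix (Q 1) i j) * X 1

/-- `pf (x Q₁ + z Q₂)`, where `pf = c₁₂ c₃₄ + c₁₃ c₂₄ + c₁₄ c₂₃` for the quadric
`∑ i ≤ j, c_ij x_i x_j`. -/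
def pfPencil (Q : Fin 2 → MvPolynomial (Fin 4) K) : MvPolynomial (Fin 2) K :=
  pencil Q 0 1 * pencil Q 2 3 + pencil Q 0 2 * pencil Q 1 3 + pencil Q 0 3 * pencil Q 1 2

/-- `rd (x Q₁ + z Q₂)`, where `det = pf² + 4 rd`. -/
def rdPencil (Q : Fin 2 → MvPolynomial (Fin 4) K) : MvPolynomial (Fin 2) K :=
  C (1 / 4) * ((pencil Q).det - pfPencil Q ^ 2)

/-- `F₄ = F₂(T₁, -T₂)`, with `F₂` that of the binary quartic `(pf, rd)(x Q₁ + z Q₂)`. -/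
def F4 (Q : Fin 2 → MvPolynomial (Fin 4) K) : MvPolynomial (Fin 4) K :=
  aeval ![T1 Q, -T2 Q] (F2 (pfPencil Q) (rdPencil Q))

/-- `G₄ = G₂(T₁, -T₂)`, with `G₂` that of the binary quartic `(pf, rd)(x Q₁ + z Q₂)`. -/
def G4 (Q : Fin 2 → MvPolynomial (Fin 4) K) : MvPolynomial (Fin 4) K :=
  aeval ![T1 Q, -T2 Q] (G2 (pfPencil Q) (rdPencil Q))

end Degree4

/-! ### Points on the curve, and the quantity `max (|F_n|, |G_n|)` -/

section Points
variable {K : Type*} [Field K]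

/-- `(x₁ : x₂ : y)` is a `K`-point of the curve `y² + P y = Q` in `ℙ(1, 1, 2)`. -/
def Model2.IsPoint (Φ : Model2 K) (x : Fin 2 → K) (y : K) : Prop :=
  (x ≠ 0 ∨ y ≠ 0) ∧ y ^ 2 + eval x Φ.P * y = eval x Φ.Q

/-- `(x₁ : x₂ : x₃)` is a `K`-point of the curve `U = 0` in `ℙ²`. -/
def Model3.IsPoint (Φ : Model3 K) (x : Fin 3 → K) : Prop :=
  x ≠ 0 ∧ eval x Φ.U = 0

/-- `(x₁ : x₂ : x₃ : x₄)` is a `K`-point of the curve `Q₁ = Q₂ = 0` in `ℙ³`. -/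
def Model4.IsPoint (Φ : Model4 K) (x : Fin 4 → K) : Prop :=
  x ≠ 0 ∧ ∀ i, eval x (Φ.Q i) = 0

variable (abv : AbsoluteValue K ℝ)

/-- `max (|F₂(x)|, |G₂(x)|)`. -/
def Model2.maxFG (Φ : Model2 K) (x : Fin 2 → K) : ℝ :=
  max (abv (eval x (F2 Φ.P Φ.Q))) (abv (eval x (G2 Φ.P Φ.Q)))

/-- `max (|F₃(x)|, |G₃(x)|)`. -/
def Model3.maxFG (Φ : Model3 K) (x : Fin 3 → K) : ℝ :=
  max (abv (eval x (F3 Φ.U))) (abv (eval x (G3 Φ.U)))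

/-- `max (|F₄(x)|, |G₄(x)|)`. -/
def Model4.maxFG (Φ : Model4 K) (x : Fin 4 → K) : ℝ :=
  max (abv (eval x (F4 Φ.Q))) (abv (eval x (G4 Φ.Q)))

/-- `max (|x₁|, …, |x_n|)`. -/
def maxCoord {n : ℕ} [NeZero n] (x : Fin n → K) : ℝ :=
  Finset.univ.sup' Finset.univ_nonempty fun i => abv (x i)

/-- The set of Tamagawa distances of a model of degree 2: those `α` such that
`max (|F₂(x)|, |G₂(x)|) / max (|x₁|, |x₂|) ^ 4 = |π| ^ (2 α)` for some `(x₁ : x₂ : y) ∈ C(K)`. -/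
def Model2.tamagawaDistances (π : K) (Φ : Model2 K) : Set ℝ :=
  {α | ∃ x y, Φ.IsPoint x y ∧ Φ.maxFG abv x / maxCoord abv x ^ (2 * 2) = abv π ^ (2 * α)}

/-- The set of Tamagawa distances of a model of degree 3. -/
def Model3.tamagawaDistances (π : K) (Φ : Model3 K) : Set ℝ :=
  {α | ∃ x, Φ.IsPoint x ∧ Φ.maxFG abv x / maxCoord abv x ^ (2 * 3) = abv π ^ (2 * α)}

/-- The set of Tamagawa distances of a model of degree 4. -/
def Model4.tamagawaDistances (π : K) (Φ : Model4 K) : Set ℝ :=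
  {α | ∃ x, Φ.IsPoint x ∧ Φ.maxFG abv x / maxCoord abv x ^ (2 * 4) = abv π ^ (2 * α)}

end Points

/-! ### The local field -/

section Local

/-- The ring of integers `𝒪_K = {x : |x| ≤ 1}`. -/
abbrev ringOfInts (K : Type*) [NormedField K] [IsUltrametricDist K] : Subring K :=
  (NormedField.valuation (K := K)).integer

variable {K : Type*} [NormedField K] [IsUltrametricDist K]

/-- `a` is a unit of `𝒪_K`. -/
def IsIntegerUnit (a : K) : Prop := ∃ u : (ringOfInts K)ˣ, ((u : ringOfInts K) : K) = a

/-- `g` is integral: it comes from a transformation over `𝒪_K`, i.e. `μ ∈ 𝒪_K^×`, `r ∈ 𝒪_K³`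
and `N ∈ GL₂(𝒪_K)`. -/
def Trans2.IsIntegral (g : Trans2 K) : Prop :=
  ∃ g₀ : Trans2 (ringOfInts K), g₀.map (ringOfInts K).subtype = g

/-- `g` is integral: `μ ∈ 𝒪_K^×` and `N ∈ GL₃(𝒪_K)`. -/
def Trans3.IsIntegral (g : Trans3 K) : Prop :=
  ∃ g₀ : Trans3 (ringOfInts K), g₀.map (ringOfInts K).subtype = g

/-- `g` is integral: `M ∈ GL₂(𝒪_K)` and `N ∈ GL₄(𝒪_K)`. -/
def Trans4.IsIntegral (g : Trans4 K) : Prop :=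
  ∃ g₀ : Trans4 (ringOfInts K), g₀.map (ringOfInts K).subtype = g

/-- A model over `𝒪_K`, regarded as a model over `K`. -/
def Model2.toField (Φ : Model2 (ringOfInts K)) : Model2 K := Φ.map (ringOfInts K).subtype

/-- See `Model2.toField`. -/
def Model3.toField (Φ : Model3 (ringOfInts K)) : Model3 K := Φ.map (ringOfInts K).subtype

/-- See `Model2.toField`. -/
def Model4.toField (Φ : Model4 (ringOfInts K)) : Model4 K := Φ.map (ringOfInts K).subtype

end Local

end GenusOne

end

open MvPolynomial

noncomputable section

namespace GenusOne

/-! ### Substitutions, evaluation and second derivatives -/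

section Subst
variable {R : Type*} [CommRing R] {n : ℕ}

/-! In each degree there is a number `s` such that, with `d = det N`, the pair $(F,G)$ becomes
$(\alpha F,\ \beta(\delta G - sF))$ at corresponding points, where $\alpha,\beta,\delta$ are
monomials in $\mu$ and $d$ (for $n=4$, in $\det M$ and $d$). If $g$ is integral, the three monomials
are units and $s$ is integral, so the ultrametric inequality leaves $\max(|F|,|G|)$ unchanged
(`max_abv_mul_sub`), and $|d|=1$. If $g$ is diagonal, then $s=0$, and $\det g$ being a unit turns
$|\alpha|$ and $|\beta\delta|$ both into $|d|^{-2}$.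

The number `s` measures the failure of $b_2$ to be an invariant: $b_2'=\mu^2(d^2b_2+12s)$ for
$n=2,3$. The rest of $G$ is built from genuine covariants. For $n=2$, $F_2$ is the discriminant in
$y$ and $144G_2=-\det\mathrm{Hess}(F_2)-12b_2F_2$. For $n=3$, on the curve $F_3=H^2/16$ and
$192G_3=\Theta-16b_2F_3$. The substance is that $b_2$ changes by a multiple of exactly 12, which
cancels the denominator with which it enters $G$: an explicit polynomial for $n=2$ (`Trans2.shift`),
an identity in characteristic 12 for $n=3$ (`b2_congr_of_charP`).

For $n=4$ everything reduces to $n=2$. The binary quartic $(\mathrm{pf},\mathrm{rd})$ of the pencil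
undergoes a degree 2 transformation $[\det N,\rho,M]$ (`Trans4.toModel2_act`), and on the curve the
point $(T_1:-T_2)$ moves accordingly, up to the scalar $(\det N)^2(\det M)^3$
(`Trans4.pencilPoint_act`). The latter rests on an identity for $x^{T}A\,\mathrm{adj}(B)\,Ax$ when
$x^{T}Ax=x^{T}Bx=0$. Integrality of $\rho$ and $\mathrm{rd}$ holds because a symmetric matrix with
even diagonal is alternating modulo 2, so that $\mathrm{pf}$ reduces to a true Pfaffian.

Part (b) follows from (a): an element of $\mathrm{GL}_n(\mathcal O_K)$ preserves the maximum of the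
coordinates, and $g$ matches up the points of the two curves. -/

theorem eval_linSubst (N : Matrix (Fin n) (Fin n) R) (f : MvPolynomial (Fin n) R)
    (x : Fin n → R) :
    eval x (linSubst N f) = eval (fun j => ∑ i, N i j * x i) f := by
  induction f using MvPolynomial.induction_on with
  | C a => simp [linSubst]
  | add p q hp hq => simp_all [linSubst]
  | mul_X p i hp => simp_all [linSubst]

/-- The chain rule: the inner functions are linear, so their derivatives are the entries of `N`. -/
theorem pderiv_linSubst (N : Matrix (Fin n) (Fin n) R) (f : MvPolynomial (Fin n) R)
    (i : Fin n) :
    pderiv i (linSubst N f) = ∑ j, C (N i j) * linSubst N (pderiv j f) := by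
  induction f using MvPolynomial.induction_on with
  | C a => simp [linSubst]
  | add p q hp hq =>
    simp only [linSubst, map_add] at hp hq ⊢
    rw [hp, hq, ← Finset.sum_add_distrib]
    exact Finset.sum_congr rfl fun j _ => by ring
  | mul_X p k hp =>
    have h : pderiv i (∑ a, C (N a k) * X a : MvPolynomial (Fin n) R) = C (N i k) := by
      rw [map_sum, Finset.sum_eq_single i]
      · simp
      · intro b _ hb; simp [pderiv_X_of_ne hb]
      · simp
    have h2 : ∀ j, linSubst N (pderiv j (p * X k)) =
        linSubst N (pderiv j p) * (∑ a, C (N a k) * X a) +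
          if j = k then linSubst N p else 0 := by
      intro j
      rw [pderiv_mul]
      by_cases hj : j = k
      · subst hj; simp [linSubst]
      · rw [pderiv_X_of_ne (Ne.symm hj)]; simp [linSubst, hj]
    have h3 : linSubst N (p * X k) = linSubst N p * ∑ a, C (N a k) * X a := by
      simp [linSubst]
    rw [h3, pderiv_mul, hp, h, Finset.sum_congr rfl fun j _ => congrArg (C (N i j) * ·) (h2 j)]
    simp only [mul_add, Finset.sum_add_distrib, Finset.sum_mul, mul_assoc, mul_ite, mul_zero,
      Finset.sum_ite_eq', Finset.mem_univ, if_true]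
    rw [mul_comm (linSubst N p)]

/-- The matrix of second partial derivatives at a point. -/
def hessianAt (f : MvPolynomial (Fin n) R) (x : Fin n → R) : Matrix (Fin n) (Fin n) R :=
  (hessianMatrix f).map (eval x)

theorem hessianMatrix_linSubst (N : Matrix (Fin n) (Fin n) R) (f : MvPolynomial (Fin n) R) :
    hessianMatrix (linSubst N f) =
      N.map C * (hessianMatrix f).map (linSubst N) * (N.map C).transpose := by
  ext1 i j
  simp only [hessianMatrix, Matrix.of_apply, pderiv_linSubst, map_sum, pderiv_C_mul,
    Matrix.mul_apply, Matrix.map_apply, Matrix.transpose_apply, Finset.mul_sum, Finset.sum_mul]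
  exact Finset.sum_congr rfl fun k _ => Finset.sum_congr rfl fun l _ => by ring

theorem hessianMatrix_C_mul (a : R) (f : MvPolynomial (Fin n) R) :
    hessianMatrix (C a * f) = (C a : MvPolynomial (Fin n) R) • hessianMatrix f := by
  ext1 i j
  simp [hessianMatrix]

theorem hessianAt_linSubst (N : Matrix (Fin n) (Fin n) R) (f : MvPolynomial (Fin n) R)
    (x : Fin n → R) :
    hessianAt (linSubst N f) x =
      N * hessianAt f (fun j => ∑ i, N i j * x i) * N.transpose := by
  ext1 i j
  simp only [hessianAt, hessianMatrix_linSubst, Matrix.map_apply, Matrix.mul_apply,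
    Matrix.transpose_apply, map_sum, map_mul, eval_C, eval_linSubst]

theorem hessianAt_C_mul (a : R) (f : MvPolynomial (Fin n) R) (x : Fin n → R) :
    hessianAt (C a * f) x = a • hessianAt f x := by
  ext1 i j
  simp [hessianAt, hessianMatrix]

theorem eval_det_hessianMatrix (f : MvPolynomial (Fin n) R) (x : Fin n → R) :
    eval x (hessianMatrix f).det = (hessianAt f x).det := by
  rw [RingHom.map_det]; rfl

theorem map_linSubst {S : Type*} [CommRing S] (φ : R →+* S) (N : Matrix (Fin n) (Fin n) R)
    (f : MvPolynomial (Fin n) R) :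
    MvPolynomial.map φ (linSubst N f) = linSubst (N.map φ) (MvPolynomial.map φ f) := by
  induction f using MvPolynomial.induction_on with
  | C a => simp [linSubst]
  | add p q hp hq => simp_all [linSubst]
  | mul_X p i hp => simp_all [linSubst]

theorem linSubst_C (N : Matrix (Fin n) (Fin n) R) (a : R) : linSubst N (C a) = C a := by
  simp [linSubst]

theorem linSubst_mul (N : Matrix (Fin n) (Fin n) R) (f g : MvPolynomial (Fin n) R) :
    linSubst N (f * g) = linSubst N f * linSubst N g := map_mul (aeval _) f g

/-- The adjugate reverses products, so `adj N` and `adj Nᵀ` end up next to `N` and `Nᵀ`, and each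
pair contributes one factor `det N`. This governs both $\Theta$ in degree 3 and $T_1,T_2$ in degree
4. -/
theorem dotProduct_adjugate_conj (N V : Matrix (Fin n) (Fin n) R) (w : Fin n → R) :
    (N.mulVec w) ⬝ᵥ ((N * V * N.transpose).adjugate.mulVec (N.mulVec w)) =
      N.det ^ 2 * (w ⬝ᵥ V.adjugate.mulVec w) := by
  have h1 : (N * V * N.transpose).adjugate.mulVec (N.mulVec w) =
      N.det • N.transpose.adjugate.mulVec (V.adjugate.mulVec w) := by
    rw [Matrix.adjugate_mul_distrib, Matrix.adjugate_mul_distrib, Matrix.mulVec_mulVec,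
      Matrix.mul_assoc, Matrix.mul_assoc, Matrix.adjugate_mul, ← Matrix.mulVec_mulVec,
      ← Matrix.mulVec_mulVec, Matrix.smul_mulVec, Matrix.one_mulVec, Matrix.mulVec_smul,
      Matrix.mulVec_smul]
  have h2 : ∀ v, (N.mulVec w) ⬝ᵥ v = w ⬝ᵥ N.transpose.mulVec v := fun v => by
    rw [Matrix.dotProduct_mulVec, Matrix.vecMul_transpose]
  rw [h1, h2, Matrix.mulVec_smul, Matrix.mulVec_mulVec, Matrix.mul_adjugate,
    Matrix.det_transpose, Matrix.smul_mulVec, Matrix.one_mulVec, dotProduct_smul,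
    dotProduct_smul, smul_eq_mul, smul_eq_mul]
  ring

end Subst

/-! ### The absolute value -/

section AbsoluteValue
variable {K : Type*} [NormedField K] [IsUltrametricDist K] {abv : AbsoluteValue K ℝ}

/-- `abv` is known only through the order it induces, and the ultrametric inequality is a statement
about that order. -/
theorem abv_add_le_max (habv : ∀ a b : K, abv a ≤ abv b ↔ ‖a‖ ≤ ‖b‖) (a b : K) :
    abv (a + b) ≤ max (abv a) (abv b) := by
  rcases le_max_iff.1 (IsUltrametricDist.norm_add_le_max a b) with h | h
  · exact le_max_of_le_left ((habv _ _).2 h)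
  · exact le_max_of_le_right ((habv _ _).2 h)

theorem abv_le_one_iff (habv : ∀ a b : K, abv a ≤ abv b ↔ ‖a‖ ≤ ‖b‖) (a : K) :
    abv a ≤ 1 ↔ a ∈ ringOfInts K := by
  have h := habv a 1
  rw [map_one, norm_one] at h
  rw [h, Valuation.mem_integer_iff, NormedField.valuation_apply, ← NNReal.coe_le_coe]
  simp

theorem abv_unit_eq_one (habv : ∀ a b : K, abv a ≤ abv b ↔ ‖a‖ ≤ ‖b‖)
    (u : (ringOfInts K)ˣ) : abv ((u : ringOfInts K) : K) = 1 := by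
  have h1 := (abv_le_one_iff habv _).2 (u : ringOfInts K).2
  have h2 := (abv_le_one_iff habv _).2 ((u⁻¹ : (ringOfInts K)ˣ) : ringOfInts K).2
  have h3 : abv ((u : ringOfInts K) : K) * abv (((u⁻¹ : (ringOfInts K)ˣ) : ringOfInts K) : K)
      = 1 := by
    rw [← map_mul, ← Subring.coe_mul, Units.mul_inv, Subring.coe_one, map_one]
  nlinarith [abv.nonneg ((u : ringOfInts K) : K)]

theorem abv_eq_one_of_isIntegerUnit (habv : ∀ a b : K, abv a ≤ abv b ↔ ‖a‖ ≤ ‖b‖) {a : K}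
    (ha : IsIntegerUnit a) : abv a = 1 := by
  obtain ⟨u, rfl⟩ := ha
  exact abv_unit_eq_one habv u

/-- Adding an integral multiple of `F` to `G` does not change `max (|F|, |G|)`. -/
theorem max_abv_add_mul (habv : ∀ a b : K, abv a ≤ abv b ↔ ‖a‖ ≤ ‖b‖) {t : K}
    (ht : t ∈ ringOfInts K) (F G : K) :
    max (abv F) (abv (G + t * F)) = max (abv F) (abv G) := by
  have key : ∀ s ∈ ringOfInts K, ∀ G : K,
      max (abv F) (abv (G + s * F)) ≤ max (abv F) (abv G) := by
    intro s hs G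
    refine max_le (le_max_left _ _) ((abv_add_le_max habv _ _).trans
      (max_le (le_max_right _ _) (le_max_of_le_left ?_)))
    rw [map_mul]
    exact mul_le_of_le_one_left (abv.nonneg _) ((abv_le_one_iff habv s).2 hs)
  refine le_antisymm (key t ht G) ?_
  -- The reverse inequality is the same one with `-t`, which undoes the change.
  have h := key (-t) (neg_mem ht) (G + t * F)
  rwa [show G + t * F + -t * F = G by ring] at h

theorem maxCoord_le_of_integral {n : ℕ} [NeZero n]
    (habv : ∀ a b : K, abv a ≤ abv b ↔ ‖a‖ ≤ ‖b‖) (N : Matrix (Fin n) (Fin n) (ringOfInts K))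
    (x : Fin n → K) :
    maxCoord abv (fun j => ∑ i, (N i j : K) * x i) ≤ maxCoord abv x := by
  refine Finset.sup'_le _ _ fun j _ => ?_
  have hna : IsNonarchimedean abv := abv_add_le_max habv
  obtain ⟨i, -, hi⟩ := hna.finset_image_add_of_nonempty (fun i => (N i j : K) * x i)
    (Finset.univ_nonempty (α := Fin n))
  refine hi.trans ?_
  rw [map_mul]
  exact (mul_le_of_le_one_left (abv.nonneg _) ((abv_le_one_iff habv _).2 (N i j).2)).trans
    (Finset.le_sup' (fun i => abv (x i)) (Finset.mem_univ i))

theorem sum_inv_mul_sum {R : Type*} [CommRing R] {n : ℕ} (N : Matrix.GeneralLinearGroup (Fin n) R)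
    (x : Fin n → R) (k : Fin n) :
    ∑ j, (N⁻¹).1 j k * ∑ i, N.1 i j * x i = x k := by
  have h : (N.1 * (N⁻¹).1) = 1 := by rw [← Units.val_mul, mul_inv_cancel, Units.val_one]
  have h2 : ∀ i, ∑ j, N.1 i j * (N⁻¹).1 j k = (1 : Matrix (Fin n) (Fin n) R) i k := fun i => by
    rw [← h, Matrix.mul_apply]
  have h3 : ∀ i, ∑ j, (N⁻¹).1 j k * (N.1 i j * x i) = (1 : Matrix (Fin n) (Fin n) R) i k * x i :=
    fun i => by
      rw [← h2, Finset.sum_mul]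
      exact Finset.sum_congr rfl fun j _ => by ring
  simp only [Finset.mul_sum]
  rw [Finset.sum_comm, Finset.sum_congr rfl fun i _ => h3 i]
  simp [Matrix.one_apply]

theorem map_inv_val {n : ℕ} (N : Matrix.GeneralLinearGroup (Fin n) (ringOfInts K)) (i j : Fin n) :
    ((Matrix.GeneralLinearGroup.map (ringOfInts K).subtype N)⁻¹).1 i j
      = (((N⁻¹).1 i j : ringOfInts K) : K) := by
  rw [← map_inv]; rfl

theorem maxCoord_eq_of_integral {n : ℕ} [NeZero n]
    (habv : ∀ a b : K, abv a ≤ abv b ↔ ‖a‖ ≤ ‖b‖)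
    (N : Matrix.GeneralLinearGroup (Fin n) (ringOfInts K)) (x : Fin n → K) :
    maxCoord abv (fun j => ∑ i, (N.1 i j : K) * x i) = maxCoord abv x := by
  refine le_antisymm (maxCoord_le_of_integral habv N.1 x) ?_
  have h := maxCoord_le_of_integral habv (N⁻¹).1 (fun j => ∑ i, (N.1 i j : K) * x i)
  have h2 := sum_inv_mul_sum (Matrix.GeneralLinearGroup.map (ringOfInts K).subtype N) x
  simp only [map_inv_val] at h2
  have h3 : (fun j => ∑ i, ((N⁻¹).1 i j : K) * ∑ l, (N.1 l i : K) * x l) = x := funext h2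
  rwa [h3] at h

theorem exists_eq_sum_mul {R : Type*} [CommRing R] {n : ℕ}
    (N : Matrix.GeneralLinearGroup (Fin n) R) (x : Fin n → R) :
    ∃ x' : Fin n → R, ∀ j, x j = ∑ i, N.1 i j * x' i := by
  refine ⟨fun i => ∑ j, (N⁻¹).1 j i * x j, fun k => ?_⟩
  have h := sum_inv_mul_sum N⁻¹ x k
  rw [inv_inv] at h
  exact h.symm

theorem eq_zero_iff_of_eq_sum_mul {R : Type*} [CommRing R] {n : ℕ}
    (N : Matrix.GeneralLinearGroup (Fin n) R) {x x' : Fin n → R}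
    (hx : ∀ j, x j = ∑ i, N.1 i j * x' i) : x' = 0 ↔ x = 0 := by
  constructor
  · rintro rfl
    ext j
    simp [hx]
  · rintro rfl
    ext k
    have h := sum_inv_mul_sum N x' k
    simpa [← hx] using h.symm

theorem coe_det_map {n : ℕ} (N : Matrix.GeneralLinearGroup (Fin n) (ringOfInts K)) :
    (Matrix.GeneralLinearGroup.map (ringOfInts K).subtype N).1.det = (N.1.det : K) :=
  (RingHom.map_det (ringOfInts K).subtype N.1).symm

theorem abv_det_map_eq_one (habv : ∀ a b : K, abv a ≤ abv b ↔ ‖a‖ ≤ ‖b‖) {n : ℕ}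
    (N : Matrix.GeneralLinearGroup (Fin n) (ringOfInts K)) :
    abv (Matrix.GeneralLinearGroup.map (ringOfInts K).subtype N).1.det = 1 := by
  rw [coe_det_map]
  exact abv_unit_eq_one habv (Matrix.GeneralLinearGroup.det N)

/-- The effect on `max (|F|, |G|)` of an integral change of `F` and `G`. -/
theorem max_abv_mul_sub (habv : ∀ a b : K, abv a ≤ abv b ↔ ‖a‖ ≤ ‖b‖) {α β δ t : K}
    (hα : abv α = 1) (hβ : abv β = 1) (hδ : abv δ = 1) (ht : t ∈ ringOfInts K) (F G : K) :
    max (abv (α * F)) (abv (β * (δ * G - t * F))) = max (abv F) (abv G) := by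
  have h := max_abv_add_mul habv (neg_mem ht) F (δ * G)
  rw [map_mul, map_mul, hα, hβ, one_mul, one_mul, show δ * G - t * F = δ * G + -t * F by ring, h,
    map_mul, hδ, one_mul]

end AbsoluteValue

/-! ### Degree 2 -/

section BinaryForms
variable {R : Type*} [CommRing R]

theorem eq_sum_coeff2 {d : ℕ} {f : MvPolynomial (Fin 2) R} (hf : f.IsHomogeneous d) :
    f = ∑ i ∈ Finset.range (d + 1), C (coeff2 f i (d - i)) * (X 0 ^ i * X 1 ^ (d - i)) := by
  have hmon : ∀ (a : R) (i j : ℕ), C a * (X 0 ^ i * X 1 ^ j) =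
      monomial (Finsupp.single (0 : Fin 2) i + Finsupp.single 1 j) a := fun a i j => by
    rw [X_pow_eq_monomial, X_pow_eq_monomial, monomial_mul, C_mul_monomial]; simp
  ext m
  simp only [hmon, coeff_sum, coeff_monomial]
  have hm : m = Finsupp.single 0 (m 0) + Finsupp.single 1 (m 1) := by
    ext i; fin_cases i <;> simp
  by_cases hd : m 0 + m 1 = d
  · rw [Finset.sum_eq_single (m 0)]
    · rw [show d - m 0 = m 1 by omega, ← hm, if_pos rfl, coeff2, ← hm]
    · intro b _ hb
      rw [if_neg]
      intro h
      exact hb (by simpa using DFunLike.congr_fun h 0)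
    · intro h
      exact absurd (Finset.mem_range.2 (by omega)) h
  · rw [hf.coeff_eq_zero, Finset.sum_eq_zero]
    · intro i hi
      rw [if_neg]
      intro h
      have h0 := DFunLike.congr_fun h 0
      have h1 := DFunLike.congr_fun h 1
      simp at h0 h1
      have := Finset.mem_range.1 hi
      omega
    · rw [hm]
      simpa [Finsupp.degree_eq_sum] using hd

theorem eq_of_isHomogeneous_two {f : MvPolynomial (Fin 2) R} (hf : f.IsHomogeneous 2) :
    f = C (coeff2 f 2 0) * X 0 ^ 2 + C (coeff2 f 1 1) * (X 0 * X 1)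
      + C (coeff2 f 0 2) * X 1 ^ 2 := by
  conv_lhs => rw [eq_sum_coeff2 hf]
  simp [Finset.sum_range_succ]
  ring

theorem eq_of_isHomogeneous_four {f : MvPolynomial (Fin 2) R} (hf : f.IsHomogeneous 4) :
    f = C (coeff2 f 4 0) * X 0 ^ 4 + C (coeff2 f 3 1) * (X 0 ^ 3 * X 1)
      + C (coeff2 f 2 2) * (X 0 ^ 2 * X 1 ^ 2) + C (coeff2 f 1 3) * (X 0 * X 1 ^ 3)
      + C (coeff2 f 0 4) * X 1 ^ 4 := by
  conv_lhs => rw [eq_sum_coeff2 hf]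
  simp [Finset.sum_range_succ]
  ring

theorem eval_of_isHomogeneous_two {f : MvPolynomial (Fin 2) R} (hf : f.IsHomogeneous 2)
    (x : Fin 2 → R) : eval x f =
      coeff2 f 2 0 * x 0 ^ 2 + coeff2 f 1 1 * (x 0 * x 1) + coeff2 f 0 2 * x 1 ^ 2 := by
  conv_lhs => rw [eq_of_isHomogeneous_two hf]
  simp

theorem eval_of_isHomogeneous_four {f : MvPolynomial (Fin 2) R} (hf : f.IsHomogeneous 4)
    (x : Fin 2 → R) : eval x f =
      coeff2 f 4 0 * x 0 ^ 4 + coeff2 f 3 1 * (x 0 ^ 3 * x 1)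
      + coeff2 f 2 2 * (x 0 ^ 2 * x 1 ^ 2) + coeff2 f 1 3 * (x 0 * x 1 ^ 3)
      + coeff2 f 0 4 * x 1 ^ 4 := by
  conv_lhs => rw [eq_of_isHomogeneous_four hf]
  simp

/-- The invariant `b₂ = m² + 4 (c - l n)`. -/
def b2Quartic (P Q : MvPolynomial (Fin 2) R) : R :=
  coeff2 P 1 1 ^ 2 + 4 * (coeff2 Q 2 2 - coeff2 P 2 0 * coeff2 P 0 2)

/-- `G₂` in terms of the Hessian of `F₂`. -/
theorem G2_eq_hessian {P Q : MvPolynomial (Fin 2) R} (hP : P.IsHomogeneous 2)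
    (hQ : Q.IsHomogeneous 4) :
    144 * G2 P Q = -(hessianMatrix (F2 P Q)).det - C (12 * b2Quartic P Q) * F2 P Q := by
  -- With $g=F_2/4$ one has $h=-\det\mathrm{Hess}(F_2)/48$, so $G_2=(h-b_2g)/3$ becomes the claim
  -- after multiplication by 144.
  have h1 := eq_of_isHomogeneous_two hP
  have h2 := eq_of_isHomogeneous_four hQ
  simp only [G2, b2Quartic, F2, Matrix.det_fin_two, hessianMatrix, Matrix.of_apply]
  generalize coeff2 P 2 0 = l at *
  generalize coeff2 P 1 1 = m at *
  generalize coeff2 P 0 2 = n at *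
  generalize coeff2 Q 4 0 = a at *
  generalize coeff2 Q 3 1 = b at *
  generalize coeff2 Q 2 2 = c at *
  generalize coeff2 Q 1 3 = d at *
  generalize coeff2 Q 0 4 = e at *
  subst h1 h2
  have h3 : (C (4 : R) : MvPolynomial (Fin 2) R) = 4 := map_ofNat C 4
  have h4 : (C (2 : R) : MvPolynomial (Fin 2) R) = 2 := map_ofNat C 2
  have h5 : (C (12 : R) : MvPolynomial (Fin 2) R) = 12 := map_ofNat C 12
  have h8 : (C (8 : R) : MvPolynomial (Fin 2) R) = 8 := map_ofNat C 8
  have h16 : (C (16 : R) : MvPolynomial (Fin 2) R) = 16 := map_ofNat C 16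
  have h01 : pderiv (0 : Fin 2) (X 1 : MvPolynomial (Fin 2) R) = 0 := pderiv_X_of_ne (by decide)
  have h10 : pderiv (1 : Fin 2) (X 0 : MvPolynomial (Fin 2) R) = 0 := pderiv_X_of_ne (by decide)
  have h20 : ∀ i : Fin 2, pderiv i (2 : MvPolynomial (Fin 2) R) = 0 := fun i => by
    rw [← h4, pderiv_C]
  have h30 : ∀ i : Fin 2, pderiv i (3 : MvPolynomial (Fin 2) R) = 0 := fun i => by
    rw [← map_ofNat C 3, pderiv_C]
  have h40 : ∀ i : Fin 2, pderiv i (4 : MvPolynomial (Fin 2) R) = 0 := fun i => by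
    rw [← h3, pderiv_C]
  simp only [h3, h4, h5, h8, h16, h01, h10, map_add, map_sub, map_mul, map_neg, map_pow,
    pderiv_mul, pderiv_pow, pderiv_C, pderiv_X_self]
  push_cast
  simp only [h20, h30, h40, map_zero, pderiv_one]
  ring

end BinaryForms

/-! ### Degree 2: how $b_2$, $F_2$ and $G_2$ transform. -/

section Transformation
variable {K : Type*} [Field K]

theorem eval_G2 {P Q : MvPolynomial (Fin 2) K} (hP : P.IsHomogeneous 2)
    (hQ : Q.IsHomogeneous 4) (x : Fin 2 → K) :
    144 * eval x (G2 P Q) =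
      -(hessianAt (F2 P Q) x).det - 12 * b2Quartic P Q * eval x (F2 P Q) := by
  have h := congrArg (eval x) (G2_eq_hessian hP hQ)
  simpa [eval_det_hessianMatrix] using h

namespace Trans2

/-- The change of `b₂ / 12` under a transformation, up to scaling. -/
def shift (g : Trans2 K) (Φ : Model2 K) : K :=
  let l := coeff2 Φ.P 2 0
  let m := coeff2 Φ.P 1 1
  let n := coeff2 Φ.P 0 2
  -- `a`, …, `e` are the coefficients of $Q-\rho P-\rho^2$, and `w` is the permanent of `N`.
  let a := coeff2 Φ.Q 4 0 - g.r 0 * l - g.r 0 ^ 2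
  let b := coeff2 Φ.Q 3 1 - g.r 0 * m - g.r 1 * l - 2 * g.r 0 * g.r 1
  let c := coeff2 Φ.Q 2 2 - g.r 0 * n - g.r 1 * m - g.r 2 * l - g.r 1 ^ 2 - 2 * g.r 0 * g.r 2
  let d := coeff2 Φ.Q 1 3 - g.r 1 * n - g.r 2 * m - 2 * g.r 1 * g.r 2
  let e := coeff2 Φ.Q 0 4 - g.r 2 * n - g.r 2 ^ 2
  let w := g.N.1 0 0 * g.N.1 1 1 + g.N.1 0 1 * g.N.1 1 0
  2 * a * (g.N.1 0 0 * g.N.1 1 0) ^ 2 + b * (g.N.1 0 0 * g.N.1 1 0) * w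
    + 2 * c * (g.N.1 0 0 * g.N.1 1 0) * (g.N.1 0 1 * g.N.1 1 1)
    + d * (g.N.1 0 1 * g.N.1 1 1) * w + 2 * e * (g.N.1 0 1 * g.N.1 1 1) ^ 2
    - g.N.1.det ^ 2 * (g.r 0 * n + g.r 2 * l + 2 * g.r 0 * g.r 2)

theorem eval_rForm (g : Trans2 K) (x : Fin 2 → K) :
    eval x g.rForm = g.r 0 * x 0 ^ 2 + g.r 1 * (x 0 * x 1) + g.r 2 * x 1 ^ 2 := by
  simp [rForm]

theorem eval_act_P (g : Trans2 K) (Φ : Model2 K) {x x' : Fin 2 → K}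
    (hx : ∀ j, x j = ∑ i, g.N.1 i j * x' i) :
    eval x' (g.act Φ).P = g.μ * (eval x Φ.P + 2 * eval x g.rForm) := by
  rw [act, eval_linSubst, ← funext hx]
  simp

theorem eval_act_Q (g : Trans2 K) (Φ : Model2 K) {x x' : Fin 2 → K}
    (hx : ∀ j, x j = ∑ i, g.N.1 i j * x' i) :
    eval x' (g.act Φ).Q =
      g.μ ^ 2 * (eval x Φ.Q - eval x g.rForm * eval x Φ.P - eval x g.rForm ^ 2) := by
  rw [act, eval_linSubst, ← funext hx]
  simp

/-- The defect is a multiple of 12, and $b_2$ enters $G_2$ with coefficient $-F_2/12$; so the defect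
contributes an integral multiple of $F_2$ whenever `shift` is integral. -/
theorem b2Quartic_act [CharZero K] (g : Trans2 K) (Φ : Model2 K) :
    b2Quartic (g.act Φ).P (g.act Φ).Q =
      g.μ ^ 2 * (g.N.1.det ^ 2 * b2Quartic Φ.P Φ.Q + 12 * g.shift Φ) := by
  have hp : ∀ u v : K, _ := fun u v => g.eval_act_P Φ (x' := ![u, v]) fun _ => rfl
  have hq : ∀ u v : K, _ := fun u v => g.eval_act_Q Φ (x' := ![u, v]) fun _ => rfl
  simp only [eval_of_isHomogeneous_two Φ.hP, eval_of_isHomogeneous_two (g.act Φ).hP,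
    eval_of_isHomogeneous_four Φ.hQ, eval_of_isHomogeneous_four (g.act Φ).hQ, eval_rForm,
    Fin.sum_univ_two, Matrix.cons_val_zero, Matrix.cons_val_one] at hp hq
  -- Coefficients of the new model are recovered from values: those of $P$ from $(1,0),(0,1),(1,1)$,
  -- and the only needed one of $Q$ from $2c=Q(1,1)+Q(1,-1)-2Q(1,0)-2Q(0,1)$.
  have p10 := hp 1 0
  have p01 := hp 0 1
  have p11 := hp 1 1
  have q10 := hq 1 0
  have q01 := hq 0 1
  have q11 := hq 1 1
  have q12 := hq 1 (-1)
  simp only [b2Quartic, shift, Matrix.det_fin_two]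
  generalize g.N.1 0 0 = p at *
  generalize g.N.1 0 1 = q at *
  generalize g.N.1 1 0 = r at *
  generalize g.N.1 1 1 = s at *
  have hl : coeff2 (g.act Φ).P 2 0 = g.μ * ((coeff2 Φ.P 2 0 + 2 * g.r 0) * p ^ 2
      + (coeff2 Φ.P 1 1 + 2 * g.r 1) * (p * q) + (coeff2 Φ.P 0 2 + 2 * g.r 2) * q ^ 2) := by
    linear_combination p10
  have hn : coeff2 (g.act Φ).P 0 2 = g.μ * ((coeff2 Φ.P 2 0 + 2 * g.r 0) * r ^ 2
      + (coeff2 Φ.P 1 1 + 2 * g.r 1) * (r * s) + (coeff2 Φ.P 0 2 + 2 * g.r 2) * s ^ 2) := by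
    linear_combination p01
  have hm : coeff2 (g.act Φ).P 1 1 = g.μ * (2 * (coeff2 Φ.P 2 0 + 2 * g.r 0) * (p * r)
      + (coeff2 Φ.P 1 1 + 2 * g.r 1) * (p * s + q * r)
      + 2 * (coeff2 Φ.P 0 2 + 2 * g.r 2) * (q * s)) := by
    linear_combination p11 - p10 - p01
  rw [hl, hn, hm]
  linear_combination 2 * (q11 + q12) - 4 * (q10 + q01)

/-- `shift` is a polynomial with integer coefficients in the entries of $g$ and the coefficients of
the model. -/
theorem shift_mem (g : Trans2 K) (Φ : Model2 K) (S : Subring K) (hr : ∀ i, g.r i ∈ S)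
    (hN : ∀ i j, g.N.1 i j ∈ S) (hP : ∀ i j, coeff2 Φ.P i j ∈ S)
    (hQ : ∀ i j, coeff2 Φ.Q i j ∈ S) : g.shift Φ ∈ S := by
  simp only [shift, Matrix.det_fin_two]
  repeat' first
    | apply hr | apply hN | apply hP | apply hQ
    | apply ofNat_mem | apply add_mem | apply sub_mem | apply pow_mem | apply mul_mem

/-- Every term contains an $r_i$ or a product of the two entries in one column of `N`. -/
theorem shift_eq_zero_of_isDiagonal {g : Trans2 K} (hg : g.IsDiagonal) (Φ : Model2 K) :
    g.shift Φ = 0 := by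
  have h01 : g.N.1 0 1 = 0 := hg.2 (by decide)
  have h10 : g.N.1 1 0 = 0 := hg.2 (by decide)
  simp [shift, hg.1, h01, h10]

/-- Completing the square: $(P+2\rho)^2+4(Q-\rho P-\rho^2)=P^2+4Q$, so $\rho$ disappears. -/
theorem F2_act (g : Trans2 K) (Φ : Model2 K) :
    F2 (g.act Φ).P (g.act Φ).Q = linSubst g.N.1 (C ((g.μ : K) ^ 2) * F2 Φ.P Φ.Q) := by
  have h2 : (C 2 : MvPolynomial (Fin 2) K) = 2 := map_ofNat C 2
  have h4 : (C 4 : MvPolynomial (Fin 2) K) = 4 := map_ofNat C 4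
  simp only [F2, act, linSubst, h2, h4, map_add, map_sub, map_mul, map_pow, map_ofNat]
  ring

theorem eval_F2_act (g : Trans2 K) (Φ : Model2 K) {x x' : Fin 2 → K}
    (hx : ∀ j, x j = ∑ i, g.N.1 i j * x' i) :
    eval x' (F2 (g.act Φ).P (g.act Φ).Q) = g.μ ^ 2 * eval x (F2 Φ.P Φ.Q) := by
  rw [F2_act, eval_linSubst, ← funext hx]
  simp

/-- The Hessian determinant of $F_2$ is a covariant, scaling by $\mu^4(\det N)^2$; the only other
contribution is the defect of $b_2$. -/
theorem eval_G2_act [CharZero K] (g : Trans2 K) (Φ : Model2 K) {x x' : Fin 2 → K}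
    (hx : ∀ j, x j = ∑ i, g.N.1 i j * x' i) :
    eval x' (G2 (g.act Φ).P (g.act Φ).Q) = g.μ ^ 4 *
      (g.N.1.det ^ 2 * eval x (G2 Φ.P Φ.Q) - g.shift Φ * eval x (F2 Φ.P Φ.Q)) := by
  have h := eval_G2 Φ.hP Φ.hQ x
  have h' := eval_G2 (g.act Φ).hP (g.act Φ).hQ x'
  have hH : (hessianAt (F2 (g.act Φ).P (g.act Φ).Q) x').det =
      g.μ ^ 4 * g.N.1.det ^ 2 * (hessianAt (F2 Φ.P Φ.Q) x).det := by
    rw [F2_act, hessianAt_linSubst, ← funext hx, hessianAt_C_mul]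
    simp only [Matrix.det_mul, Matrix.det_transpose, Matrix.det_smul, Fintype.card_fin]
    ring
  rw [b2Quartic_act, eval_F2_act g Φ hx, hH] at h'
  refine mul_left_cancel₀ (a := (144 : K)) (by norm_num) ?_
  linear_combination h' - g.μ ^ 4 * g.N.1.det ^ 2 * h

end Trans2

end Transformation

/-! ### Degree 2: absolute values, points and distances. -/

section
variable {K : Type*} [NormedField K] [IsUltrametricDist K] [CharZero K] {abv : AbsoluteValue K ℝ}

theorem coeff2_map {R S : Type*} [CommRing R] [CommRing S] (φ : R →+* S)
    (f : MvPolynomial (Fin 2) R) (i j : ℕ) :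
    coeff2 (MvPolynomial.map φ f) i j = φ (coeff2 f i j) :=
  coeff_map _ _ _

/-- The transformation formula for `max (|F₂|, |G₂|)` under integral transformations. -/
theorem Trans2.max_abv_act_of_isIntegral (habv : ∀ a b : K, abv a ≤ abv b ↔ ‖a‖ ≤ ‖b‖)
    {g : Trans2 K} (hg : g.IsIntegral) {Φ : Model2 K}
    (hP : ∀ i j, coeff2 Φ.P i j ∈ ringOfInts K) (hQ : ∀ i j, coeff2 Φ.Q i j ∈ ringOfInts K)
    {x x' : Fin 2 → K} (hx : ∀ j, x j = ∑ i, g.N.1 i j * x' i) :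
    (g.act Φ).maxFG abv x' = Φ.maxFG abv x := by
  obtain ⟨g₀, rfl⟩ := hg
  have hμ : abv ((g₀.map (ringOfInts K).subtype).μ : K) = 1 := abv_unit_eq_one habv g₀.μ
  have hδ : abv (g₀.map (ringOfInts K).subtype).N.1.det = 1 := abv_det_map_eq_one habv g₀.N
  rw [Model2.maxFG, Model2.maxFG, eval_F2_act _ _ hx, eval_G2_act _ _ hx]
  refine max_abv_mul_sub habv (by rw [map_pow, hμ, one_pow]) (by rw [map_pow, hμ, one_pow])
    (by rw [map_pow, hδ, one_pow]) ?_ _ _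
  exact shift_mem _ _ _ (fun i => (g₀.r i).2) (fun i j => (g₀.N.1 i j).2) hP hQ

/-- In the diagonal case $|\mu|=|\det N|^{-1}$, so the factors $\mu^2$ of $F_2$ and $\mu^4(\det
N)^2$ of $G_2$ both have absolute value $|\det N|^{-2}$. The formulas are identities of forms, so no
equation of the curve is needed here. -/
theorem Model2.maxFG_act (habv : ∀ a b : K, abv a ≤ abv b ↔ ‖a‖ ≤ ‖b‖)
    (Φ : Model2 (ringOfInts K)) (g : Trans2 K)
    (hg : g.IsIntegral ∨ (IsIntegerUnit g.det ∧ g.IsDiagonal)) {x x' : Fin 2 → K}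
    (hx : ∀ j, x j = ∑ i, g.N.1 i j * x' i) :
    (g.act Φ.toField).maxFG abv x' = abv g.N.1.det ^ (-2 : ℤ) * Φ.toField.maxFG abv x := by
  rcases hg with hg | ⟨hu, hd⟩
  · have h1 : abv g.N.1.det = 1 := by
      obtain ⟨g₀, rfl⟩ := hg
      exact abv_det_map_eq_one habv g₀.N
    rw [Trans2.max_abv_act_of_isIntegral habv hg _ _ hx, h1, one_zpow, one_mul]
    · exact fun i j => by rw [toField, map, coeff2_map]; exact (coeff2 Φ.P i j).2
    · exact fun i j => by rw [toField, map, coeff2_map]; exact (coeff2 Φ.Q i j).2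
  · have h1 := abv_eq_one_of_isIntegerUnit habv hu
    rw [Trans2.det, map_mul] at h1
    have h2 : abv (g.μ : K) = (abv g.N.1.det)⁻¹ := eq_inv_of_mul_eq_one_left h1
    have h3 : abv g.N.1.det ≠ 0 := right_ne_zero_of_mul_eq_one h1
    rw [maxFG, maxFG, Trans2.eval_F2_act _ _ hx, Trans2.eval_G2_act _ _ hx,
      Trans2.shift_eq_zero_of_isDiagonal hd, mul_max_of_nonneg _ _ (by positivity)]
    simp only [map_mul, map_pow, zero_mul, sub_zero, h2]
    congr 1 <;> field_simp

end

section
variable {R S : Type*} [CommRing R] [CommRing S]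

theorem Trans2.map_act (φ : R →+* S) (g : Trans2 R) (Φ : Model2 R) :
    (g.act Φ).map φ = (g.map φ).act (Φ.map φ) := by
  have h2 : φ 2 = 2 := map_ofNat φ 2
  simp [Model2.map, act, map_linSubst, rForm, Trans2.map, h2]

/-- The substitution $y\leftarrow\mu^{-1}y+\rho$ sends the $y$-coordinate to $\mu(y-\rho(x))$; when
$x=0$ the form $\rho$ vanishes, so $y\neq0$ is preserved too. -/
theorem Trans2.isPoint_act_iff {K : Type*} [Field K] (g : Trans2 K) (Φ : Model2 K)
    {x x' : Fin 2 → K} (hx : ∀ j, x j = ∑ i, g.N.1 i j * x' i) (y : K) :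
    (g.act Φ).IsPoint x' (g.μ * (y - eval x g.rForm)) ↔ Φ.IsPoint x y := by
  have hμ : (g.μ : K) ≠ 0 := g.μ.ne_zero
  rw [Model2.IsPoint, Model2.IsPoint, g.eval_act_P Φ hx, g.eval_act_Q Φ hx]
  refine and_congr ?_ ?_
  · rw [Ne, Ne, eq_zero_iff_of_eq_sum_mul g.N hx]
    by_cases h : x = 0
    · have h0 : eval x g.rForm = 0 := by rw [eval_rForm, h]; simp
      simp [hμ, h0]
    · simp [h]
  · have hμ2 : (g.μ : K) ^ 2 ≠ 0 := pow_ne_zero _ hμ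
    rw [← mul_right_inj' hμ2 (b := y ^ 2 + _)]
    constructor <;> intro h <;> linear_combination h

end

/-- `N` has unit determinant and preserves `maxCoord`, so the defining quotient takes equal values
at corresponding points; the correspondence of points is onto in both directions. -/
theorem Model2.tamagawaDistances_eq {K : Type*} [NormedField K] [IsUltrametricDist K]
    [CharZero K] {abv : AbsoluteValue K ℝ}
    (habv : ∀ a b : K, abv a ≤ abv b ↔ ‖a‖ ≤ ‖b‖) (π : K) {Φ Φ' : Model2 (ringOfInts K)}
    (h : Φ.Equivalent Φ') :
    Φ.toField.tamagawaDistances abv π = Φ'.toField.tamagawaDistances abv π := by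
  obtain ⟨g₀, rfl⟩ := h
  have hact : (g₀.act Φ).toField = (g₀.map (ringOfInts K).subtype).act Φ.toField :=
    Trans2.map_act _ _ _
  set g := g₀.map (ringOfInts K).subtype with hg
  have hmax : ∀ x x' : Fin 2 → K, (∀ j, x j = ∑ i, g.N.1 i j * x' i) →
      (g.act Φ.toField).maxFG abv x' / maxCoord abv x' ^ (2 * 2) =
        Φ.toField.maxFG abv x / maxCoord abv x ^ (2 * 2) := by
    intro x x' hx
    rw [maxFG_act habv Φ g (Or.inl ⟨g₀, rfl⟩) hx, hg]
    change abv (Matrix.GeneralLinearGroup.map (ringOfInts K).subtype g₀.N).1.det ^ _ * _ / _ = _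
    rw [abv_det_map_eq_one habv, one_zpow, one_mul, ← maxCoord_eq_of_integral habv g₀.N x',
      funext hx]
    rfl
  rw [hact]
  ext α
  constructor
  · rintro ⟨x, y, hp, hα⟩
    obtain ⟨x', hx⟩ := exists_eq_sum_mul g.N x
    exact ⟨x', _, (g.isPoint_act_iff _ hx y).2 hp, by rw [hmax x x' hx, hα]⟩
  · rintro ⟨x', y', hp, hα⟩
    have hμ : (g.μ : K) ≠ 0 := g.μ.ne_zero
    set x : Fin 2 → K := fun j => ∑ i, g.N.1 i j * x' i with hx
    -- The preimage of `y'` is obtained by solving $y'=\mu(y-\rho(x))$ for $y$.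
    refine ⟨x, y' / g.μ + eval x g.rForm, ?_, by rw [← hmax x x' fun _ => rfl, hα]⟩
    rw [← g.isPoint_act_iff _ (fun _ => rfl)]
    convert hp using 1
    field_simp
    ring

/-! ### Degree 3 -/

theorem eq_sum_monomial_of_isHomogeneous {R : Type*} [CommRing R] {d : ℕ}
    {f : MvPolynomial (Fin 3) R} (hf : f.IsHomogeneous d) :
    f = ∑ i ∈ Finset.range (d + 1), ∑ j ∈ Finset.range (d + 1 - i),
      monomial (Finsupp.single 0 i + Finsupp.single 1 j + Finsupp.single 2 (d - i - j))
        (coeff (Finsupp.single 0 i + Finsupp.single 1 j + Finsupp.single 2 (d - i - j)) f) := by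
  ext m
  simp only [coeff_sum, coeff_monomial]
  have hm : m = Finsupp.single 0 (m 0) + Finsupp.single 1 (m 1) + Finsupp.single 2 (m 2) := by
    ext i; fin_cases i <;> simp
  by_cases hd : m 0 + m 1 + m 2 = d
  · rw [Finset.sum_eq_single (m 0), Finset.sum_eq_single (m 1)]
    · rw [show d - m 0 - m 1 = m 2 by omega, ← hm, if_pos rfl]
    · intro b _ hb
      rw [if_neg]
      intro h
      exact hb (by simpa using DFunLike.congr_fun h 1)
    · intro h
      exact absurd (Finset.mem_range.2 (by omega)) h
    · intro b _ hb
      refine Finset.sum_eq_zero fun j _ => ?_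
      rw [if_neg]
      intro h
      exact hb (by simpa using DFunLike.congr_fun h 0)
    · intro h
      exact absurd (Finset.mem_range.2 (by omega)) h
  · rw [hf.coeff_eq_zero, Finset.sum_eq_zero]
    · intro i hi
      refine Finset.sum_eq_zero fun j hj => ?_
      rw [if_neg]
      intro h
      have h0 := DFunLike.congr_fun h 0
      have h1 := DFunLike.congr_fun h 1
      have h2 := DFunLike.congr_fun h 2
      simp at h0 h1 h2
      have := Finset.mem_range.1 hi
      have := Finset.mem_range.1 hj
      omega
    · rw [hm]
      simpa [Finsupp.degree_eq_sum, Fin.sum_univ_three] using hd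

/-! ### Degree 3: the congruence for $b_2$ modulo 12. -/

/-- The value at `x` of the ternary cubic with the given coefficients. -/
def cubicValue {R : Type*} [CommRing R] (a b c f g h i j k m : R) (x : Fin 3 → R) : R :=
  a * x 0 ^ 3 + b * x 1 ^ 3 + c * x 2 ^ 3 + f * x 1 ^ 2 * x 2 + g * x 2 ^ 2 * x 0
    + h * x 0 ^ 2 * x 1 + i * x 1 * x 2 ^ 2 + j * x 2 * x 0 ^ 2 + k * x 0 * x 1 ^ 2
    + m * x 0 * x 1 * x 2

theorem eval_eq_cubicValue {K : Type*} [Field K] {U : MvPolynomial (Fin 3) K}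
    (hU : U.IsHomogeneous 3) (x : Fin 3 → K) :
    eval x U = cubicValue (coeff3 U 3 0 0) (coeff3 U 0 3 0) (coeff3 U 0 0 3) (coeff3 U 0 2 1)
      (coeff3 U 1 0 2) (coeff3 U 2 1 0) (coeff3 U 0 1 2) (coeff3 U 2 0 1) (coeff3 U 1 2 0)
      (coeff3 U 1 1 1) x := by
  conv_lhs => rw [eq_sum_monomial_of_isHomogeneous hU]
  have hmon : ∀ (i j k : ℕ) (r : K), eval x (monomial (Finsupp.single (0 : Fin 3) i +
      Finsupp.single 1 j + Finsupp.single 2 k) r) = r * (x 0 ^ i * x 1 ^ j * x 2 ^ k) := by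
    intro i j k r
    rw [eval_monomial, Finsupp.prod_add_index', Finsupp.prod_add_index'] <;>
      simp [pow_add]
  simp only [map_sum, hmon]
  simp only [← coeff3.eq_1, Finset.sum_range_succ, Finset.sum_range_zero, cubicValue]
  norm_num
  ring

/-- The value `D_v U(u)` for the ternary cubic `U` with the given coefficients. -/
def cubicPolar {R : Type*} [CommRing R] (a b c f g h i j k m : R) (u v : Fin 3 → R) : R :=
  3 * a * u 0 ^ 2 * v 0 + 3 * b * u 1 ^ 2 * v 1 + 3 * c * u 2 ^ 2 * v 2
    + f * (u 1 ^ 2 * v 2 + 2 * u 1 * u 2 * v 1) + g * (u 2 ^ 2 * v 0 + 2 * u 0 * u 2 * v 2)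
    + h * (u 0 ^ 2 * v 1 + 2 * u 0 * u 1 * v 0) + i * (u 2 ^ 2 * v 1 + 2 * u 1 * u 2 * v 2)
    + j * (u 0 ^ 2 * v 2 + 2 * u 0 * u 2 * v 0) + k * (u 1 ^ 2 * v 0 + 2 * u 0 * u 1 * v 1)
    + m * (u 0 * u 1 * v 2 + u 0 * u 2 * v 1 + u 1 * u 2 * v 0)

/-- The polarisation `D_u D_v U(w)` of the ternary cubic `U` with the given coefficients. -/
def cubicPolar₃ {R : Type*} [CommRing R] (a b c f g h i j k m : R) (u v w : Fin 3 → R) : R :=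
  6 * a * u 0 * v 0 * w 0 + 6 * b * u 1 * v 1 * w 1 + 6 * c * u 2 * v 2 * w 2
    + 2 * f * (u 1 * v 1 * w 2 + u 1 * v 2 * w 1 + u 2 * v 1 * w 1)
    + 2 * g * (u 2 * v 2 * w 0 + u 2 * v 0 * w 2 + u 0 * v 2 * w 2)
    + 2 * h * (u 0 * v 0 * w 1 + u 0 * v 1 * w 0 + u 1 * v 0 * w 0)
    + 2 * i * (u 2 * v 2 * w 1 + u 2 * v 1 * w 2 + u 1 * v 2 * w 2)
    + 2 * j * (u 0 * v 0 * w 2 + u 0 * v 2 * w 0 + u 2 * v 0 * w 0)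
    + 2 * k * (u 1 * v 1 * w 0 + u 1 * v 0 * w 1 + u 0 * v 1 * w 1)
    + m * (u 0 * v 1 * w 2 + u 0 * v 2 * w 1 + u 1 * v 0 * w 2 + u 1 * v 2 * w 0
      + u 2 * v 0 * w 1 + u 2 * v 1 * w 0)

/-- The left side is $b_2$ of the substituted cubic: its coefficients are the polar values at the
rows of `N`. Working in characteristic 12 replaces the large explicit quotient by 12 with a plain
polynomial identity. -/
theorem b2_congr_of_charP {R : Type*} [CommRing R] [CharP R 12] (a b c f g h i j k m : R)
    (N : Matrix (Fin 3) (Fin 3) R) :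
    cubicPolar₃ a b c f g h i j k m (N 0) (N 1) (N 2) ^ 2 + 4 * (-(
      cubicPolar a b c f g h i j k m (N 1) (N 2) * cubicPolar a b c f g h i j k m (N 0) (N 2)
      + cubicPolar a b c f g h i j k m (N 2) (N 0) * cubicPolar a b c f g h i j k m (N 1) (N 0)
      + cubicPolar a b c f g h i j k m (N 0) (N 1) * cubicPolar a b c f g h i j k m (N 2) (N 1)))
      = N.det ^ 2 * (m ^ 2 + 4 * (-(f * j + g * k + h * i))) := by
  rw [Matrix.det_fin_three]
  simp only [cubicPolar, cubicPolar₃]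
  generalize N 0 0 = n00
  generalize N 0 1 = n01
  generalize N 0 2 = n02
  generalize N 1 0 = n10
  generalize N 1 1 = n11
  generalize N 1 2 = n12
  generalize N 2 0 = n20
  generalize N 2 1 = n21
  generalize N 2 2 = n22
  grind

/-- The characteristic of `R ⧸ (n)` may be a proper divisor of `n`, for instance 1 when `n` is a
unit; the factor `ZMod n` makes it exactly `n`. -/
theorem charP_quotient_prod_zmod (R : Type*) [CommRing R] (n : ℕ) :
    CharP ((R ⧸ Ideal.span {(n : R)}) × ZMod n) n := by
  refine ⟨fun k => ⟨fun h => (ZMod.natCast_eq_zero_iff k n).1 (congrArg Prod.snd h), ?_⟩⟩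
  rintro ⟨m, rfl⟩
  have h : (n : R ⧸ Ideal.span {(n : R)}) = 0 := by
    rw [← map_natCast (Ideal.Quotient.mk _), Ideal.Quotient.eq_zero_iff_mem]
    exact Ideal.mem_span_singleton_self _
  ext <;> simp [h]

theorem exists_b2_shift {R : Type*} [CommRing R] (a b c f g h i j k m : R)
    (N : Matrix (Fin 3) (Fin 3) R) : ∃ s : R,
    cubicPolar₃ a b c f g h i j k m (N 0) (N 1) (N 2) ^ 2 + 4 * (-(
      cubicPolar a b c f g h i j k m (N 1) (N 2) * cubicPolar a b c f g h i j k m (N 0) (N 2)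
      + cubicPolar a b c f g h i j k m (N 2) (N 0) * cubicPolar a b c f g h i j k m (N 1) (N 0)
      + cubicPolar a b c f g h i j k m (N 0) (N 1) * cubicPolar a b c f g h i j k m (N 2) (N 1)))
      = N.det ^ 2 * (m ^ 2 + 4 * (-(f * j + g * k + h * i))) + 12 * s := by
  let π : R →+* R ⧸ Ideal.span {((12 : ℕ) : R)} := Ideal.Quotient.mk _
  -- The `ZMod 12` component carries no information, so 0 serves there. `e` itself is not a ring
  -- homomorphism, but its first component is the quotient map, and only that is used.
  let e : R → (R ⧸ Ideal.span {((12 : ℕ) : R)}) × ZMod 12 := fun r => (π r, 0)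
  have : CharP ((R ⧸ Ideal.span {((12 : ℕ) : R)}) × ZMod 12) 12 := charP_quotient_prod_zmod R 12
  have key := congrArg (RingHom.fst (R ⧸ Ideal.span {((12 : ℕ) : R)}) (ZMod 12))
    (b2_congr_of_charP (e a) (e b) (e c) (e f) (e g) (e h) (e i) (e j) (e k) (e m) (N.map e))
  have he : ∀ r, RingHom.fst (R ⧸ Ideal.span {((12 : ℕ) : R)}) (ZMod 12) (e r) = π r :=
    fun _ => rfl
  simp only [cubicPolar, cubicPolar₃, Matrix.det_fin_three, Matrix.map_apply, map_add, map_sub,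
    map_mul, map_neg, map_pow, map_ofNat, he] at key
  simp only [← map_ofNat π, ← map_add, ← map_mul, ← map_pow, ← map_neg, ← map_sub] at key
  rw [Ideal.Quotient.eq, Ideal.mem_span_singleton] at key
  obtain ⟨s, hs⟩ := key
  refine ⟨s, ?_⟩
  rw [sub_eq_iff_eq_add'] at hs
  simpa only [cubicPolar, cubicPolar₃, Matrix.det_fin_three, Nat.cast_ofNat] using hs

/-! ### Degree 3: the action on $b_2$. -/

section
variable {K : Type*} [Field K]

namespace Trans3

theorem eval_act_U (g : Trans3 K) (Φ : Model3 K) {x x' : Fin 3 → K}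
    (hx : ∀ j, x j = ∑ i, g.N.1 i j * x' i) :
    eval x' (g.act Φ).U = g.μ * eval x Φ.U := by
  rw [act, eval_linSubst, ← funext hx]
  simp

/-- The coefficients entering `b₂` of a transformed cubic. -/
theorem coeff3_act [CharZero K] (g : Trans3 K) (Φ : Model3 K) :
    let D := cubicPolar (coeff3 Φ.U 3 0 0) (coeff3 Φ.U 0 3 0) (coeff3 Φ.U 0 0 3)
      (coeff3 Φ.U 0 2 1) (coeff3 Φ.U 1 0 2) (coeff3 Φ.U 2 1 0) (coeff3 Φ.U 0 1 2)
      (coeff3 Φ.U 2 0 1) (coeff3 Φ.U 1 2 0) (coeff3 Φ.U 1 1 1)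
    let T := cubicPolar₃ (coeff3 Φ.U 3 0 0) (coeff3 Φ.U 0 3 0) (coeff3 Φ.U 0 0 3)
      (coeff3 Φ.U 0 2 1) (coeff3 Φ.U 1 0 2) (coeff3 Φ.U 2 1 0) (coeff3 Φ.U 0 1 2)
      (coeff3 Φ.U 2 0 1) (coeff3 Φ.U 1 2 0) (coeff3 Φ.U 1 1 1)
    let N := g.N.1
    let U' := (g.act Φ).U
    coeff3 U' 0 2 1 = g.μ * D (N 1) (N 2) ∧ coeff3 U' 1 0 2 = g.μ * D (N 2) (N 0) ∧
    coeff3 U' 2 1 0 = g.μ * D (N 0) (N 1) ∧ coeff3 U' 0 1 2 = g.μ * D (N 2) (N 1) ∧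
    coeff3 U' 2 0 1 = g.μ * D (N 0) (N 2) ∧ coeff3 U' 1 2 0 = g.μ * D (N 1) (N 0) ∧
    coeff3 U' 1 1 1 = g.μ * T (N 0) (N 1) (N 2) := by
  intro D T N U'
  have h : ∀ u v w : K, _ := fun u v w => g.eval_act_U Φ (x' := ![u, v, w]) fun _ => rfl
  simp only [eval_eq_cubicValue Φ.hU, eval_eq_cubicValue (g.act Φ).hU, cubicValue,
    Fin.sum_univ_three, Matrix.cons_val_zero, Matrix.cons_val_one, Matrix.cons_val] at h
  simp only [D, T, N, U', cubicPolar, cubicPolar₃]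
  generalize (g.act Φ).U = U' at *
  generalize g.N.1 = N at *
  generalize (g.μ : K) = μ at *
  generalize coeff3 Φ.U 3 0 0 = a at *
  generalize coeff3 Φ.U 0 3 0 = b at *
  generalize coeff3 Φ.U 0 0 3 = c at *
  generalize coeff3 Φ.U 0 2 1 = f at *
  generalize coeff3 Φ.U 1 0 2 = g at *
  generalize coeff3 Φ.U 2 1 0 = h at *
  generalize coeff3 Φ.U 0 1 2 = i at *
  generalize coeff3 Φ.U 2 0 1 = j at *
  generalize coeff3 Φ.U 1 2 0 = k at *
  generalize coeff3 Φ.U 1 1 1 = m at *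
  rename _ => hv
  -- Sums and differences of the values at $e_i+e_j$ and $e_i-e_j$ separate the two mixed
  -- coefficients in $x_i,x_j$; inclusion–exclusion at $(1,1,1)$ gives the coefficient of
  -- $x_1x_2x_3$.
  have h1 := hv 1 0 0
  have h2 := hv 0 1 0
  have h3 := hv 0 0 1
  have h12 := hv 1 1 0
  have h13 := hv 1 0 1
  have h23 := hv 0 1 1
  have k12 := hv 1 (-1) 0
  have k13 := hv 1 0 (-1)
  have k23 := hv 0 1 (-1)
  have h123 := hv 1 1 1
  clear hv
  refine ⟨?_, ?_, ?_, ?_, ?_, ?_, ?_⟩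
  · linear_combination (1 / 2) * (h23 - k23) - h3
  · linear_combination (1 / 2) * (h13 + k13) - h1
  · linear_combination (1 / 2) * (h12 - k12) - h2
  · linear_combination (1 / 2) * (h23 + k23) - h2
  · linear_combination (1 / 2) * (h13 - k13) - h3
  · linear_combination (1 / 2) * (h12 + k12) - h1
  · linear_combination h123 - h12 - h13 - h23 + h1 + h2 + h3

theorem exists_b2Cubic_act [CharZero K] (g : Trans3 K) (Φ : Model3 K) (S : Subring K)
    (hN : ∀ i j, g.N.1 i j ∈ S) (hU : ∀ i j k, coeff3 Φ.U i j k ∈ S) :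
    ∃ s ∈ S, b2Cubic (g.act Φ).U =
      g.μ ^ 2 * (g.N.1.det ^ 2 * b2Cubic Φ.U + 12 * s) := by
  obtain ⟨hf, hg, hh, hi, hj, hk, hm⟩ := g.coeff3_act Φ
  -- The congruence is used over `S`, not over `K`, where divisibility by 12 would say nothing.
  obtain ⟨s, hs⟩ := exists_b2_shift (R := S) ⟨_, hU 3 0 0⟩ ⟨_, hU 0 3 0⟩ ⟨_, hU 0 0 3⟩
    ⟨_, hU 0 2 1⟩ ⟨_, hU 1 0 2⟩ ⟨_, hU 2 1 0⟩ ⟨_, hU 0 1 2⟩ ⟨_, hU 2 0 1⟩ ⟨_, hU 1 2 0⟩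
    ⟨_, hU 1 1 1⟩ (Matrix.of fun i j => ⟨_, hN i j⟩)
  refine ⟨s, s.2, ?_⟩
  have h := congrArg S.subtype hs
  simp only [cubicPolar, cubicPolar₃, Matrix.det_fin_three, Matrix.of_apply, map_add, map_sub,
    map_mul, map_neg, map_pow, map_ofNat, Subring.subtype_apply] at h
  simp only [b2Cubic, hf, hg, hh, hi, hj, hk, hm, cubicPolar, cubicPolar₃,
    Matrix.det_fin_three]
  linear_combination (g.μ : K) ^ 2 * h

/-- For diagonal `N` each coefficient is multiplied by $\mu$ and its monomial in the diagonal
entries; $m^2$, $fj$, $gk$ and $hi$ all acquire the same factor $\mu^2(\det N)^2$. -/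
theorem b2Cubic_act_of_isDiagonal [CharZero K] {g : Trans3 K} (hg : g.IsDiagonal) (Φ : Model3 K) :
    b2Cubic (g.act Φ).U = g.μ ^ 2 * (g.N.1.det ^ 2 * b2Cubic Φ.U) := by
  obtain ⟨hf, hg', hh, hi, hj, hk, hm⟩ := g.coeff3_act Φ
  have h01 : g.N.1 0 1 = 0 := hg (by decide)
  have h02 : g.N.1 0 2 = 0 := hg (by decide)
  have h10 : g.N.1 1 0 = 0 := hg (by decide)
  have h12 : g.N.1 1 2 = 0 := hg (by decide)
  have h20 : g.N.1 2 0 = 0 := hg (by decide)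
  have h21 : g.N.1 2 1 = 0 := hg (by decide)
  simp only [b2Cubic, hf, hg', hh, hi, hj, hk, hm, cubicPolar, cubicPolar₃,
    Matrix.det_fin_three, h01, h02, h10, h12, h20, h21]
  ring

end Trans3

end

/-! ### Degree 3: the covariants $H$ and $\Theta$, and the forms $F_3$, $G_3$ on the curve. -/

section
variable {K : Type*} [Field K]

theorem hessianCubic_linSubst (N : Matrix (Fin 3) (Fin 3) K) (μ : K)
    (U : MvPolynomial (Fin 3) K) :
    hessianCubic (linSubst N (C μ * U)) =
      C (μ ^ 3 * N.det ^ 2) * linSubst N (hessianCubic U) := by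
  have h : ((hessianMatrix U).map (linSubst N)).det = linSubst N (hessianMatrix U).det :=
    (AlgHom.map_det (aeval _) (hessianMatrix U)).symm
  have h2 : (N.map C).det = (C N.det : MvPolynomial (Fin 3) K) := (RingHom.map_det C N).symm
  have h3 : (hessianMatrix (C μ * U)).map (linSubst N) =
      (C μ : MvPolynomial (Fin 3) K) • (hessianMatrix U).map (linSubst N) := by
    rw [hessianMatrix_C_mul]
    ext1 i j
    simp [linSubst_mul, linSubst_C]
  rw [hessianCubic, hessianCubic, hessianMatrix_linSubst, h3, linSubst_mul, linSubst_C]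
  simp only [Matrix.det_mul, Matrix.det_transpose, Matrix.det_smul, Fintype.card_fin, h, h2,
    map_mul, map_pow]
  ring

/-- The determinant of a bordered `3 × 3` matrix. -/
theorem det_bordered {R : Type*} [CommRing R] (V : Matrix (Fin 3) (Fin 3) R) (w : Fin 3 → R) :
    Matrix.det !![V 0 0, V 0 1, V 0 2, w 0; V 1 0, V 1 1, V 1 2, w 1;
      V 2 0, V 2 1, V 2 2, w 2; w 0, w 1, w 2, 0] = -(w ⬝ᵥ V.adjugate.mulVec w) := by
  rw [Matrix.adjugate_fin_three, Matrix.det_succ_row_zero]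
  simp [Fin.sum_univ_succ, Matrix.det_fin_three, Matrix.mulVec, dotProduct, Fin.succAbove]
  ring

/-- This writes $\Theta$ as the quadratic form of $\mathrm{adj}(U_{ij})$ at the gradient of $H$, to
which `dotProduct_adjugate_conj` applies. -/
theorem eval_thetaCubic (U : MvPolynomial (Fin 3) K) (x : Fin 3 → K) :
    eval x (thetaCubic U) = -(1 / 3) * ((fun i => eval x (pderiv i (hessianCubic U))) ⬝ᵥ
      (hessianAt U x).adjugate.mulVec (fun i => eval x (pderiv i (hessianCubic U)))) := by
  have h := congrArg (eval x)
    (det_bordered (hessianMatrix U) (fun i => pderiv i (hessianCubic U)))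
  rw [thetaCubic, map_mul, h, hessianAt, ← RingHom.mapMatrix_apply, ← RingHom.map_adjugate]
  simp only [eval_C, map_neg, dotProduct, Matrix.mulVec, map_sum, map_mul,
    RingHom.mapMatrix_apply, Matrix.map_apply]
  ring

namespace Trans3

theorem eval_hessianCubic_act (g : Trans3 K) (Φ : Model3 K) {x x' : Fin 3 → K}
    (hx : ∀ j, x j = ∑ i, g.N.1 i j * x' i) :
    eval x' (hessianCubic (g.act Φ).U) =
      g.μ ^ 3 * g.N.1.det ^ 2 * eval x (hessianCubic Φ.U) := by
  rw [act, hessianCubic_linSubst, map_mul, eval_C, eval_linSubst, ← funext hx]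

/-- The two gradients of $H$ give $(\mu^3d^2)^2$ with $d=\det N$, the $3\times3$ adjugate is
quadratic in $\mu$, and the conjugation by `N` adds $d^2$. -/
theorem eval_thetaCubic_act (g : Trans3 K) (Φ : Model3 K) {x x' : Fin 3 → K}
    (hx : ∀ j, x j = ∑ i, g.N.1 i j * x' i) :
    eval x' (thetaCubic (g.act Φ).U) = g.μ ^ 8 * g.N.1.det ^ 6 * eval x (thetaCubic Φ.U) := by
  have hV : hessianAt (g.act Φ).U x' =
      g.N.1 * ((g.μ : K) • hessianAt Φ.U x) * g.N.1.transpose := by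
    rw [act, hessianAt_linSubst, ← funext hx, hessianAt_C_mul]
  have hw : (fun i => eval x' (pderiv i (hessianCubic (g.act Φ).U))) =
      ((g.μ : K) ^ 3 * g.N.1.det ^ 2) •
        g.N.1.mulVec (fun i => eval x (pderiv i (hessianCubic Φ.U))) := by
    ext i
    rw [act, hessianCubic_linSubst, pderiv_C_mul, pderiv_linSubst]
    simp only [map_mul, eval_C, map_sum, eval_linSubst, ← funext hx, Pi.smul_apply, smul_eq_mul,
      Matrix.mulVec, dotProduct]
  rw [eval_thetaCubic, eval_thetaCubic, hV, hw, Matrix.mulVec_smul, smul_dotProduct,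
    dotProduct_smul, dotProduct_adjugate_conj, Matrix.adjugate_smul, Matrix.smul_mulVec,
    dotProduct_smul]
  simp only [smul_eq_mul, Fintype.card_fin]
  ring

end Trans3

/-- On the curve all terms with a factor $U$ drop out, so that $F_3$ and $G_3$ depend only on $H$,
$\Theta$ and $b_2$. -/
theorem eval_ZCubic {U : MvPolynomial (Fin 3) K} {x : Fin 3 → K} (h : eval x U = 0) :
    eval x (ZCubic U) = 1 / 4 * eval x (hessianCubic U) := by
  simp [ZCubic, h]

theorem eval_F3 [CharZero K] {U : MvPolynomial (Fin 3) K} {x : Fin 3 → K} (h : eval x U = 0) :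
    eval x (F3 U) = 1 / 16 * eval x (hessianCubic U) ^ 2 := by
  rw [F3, map_pow, eval_ZCubic h]
  ring

theorem eval_G3 {U : MvPolynomial (Fin 3) K} {x : Fin 3 → K} (h : eval x U = 0) :
    eval x (G3 U) = 1 / 192 * (eval x (thetaCubic U) - 16 * b2Cubic U * eval x (F3 U)) := by
  simp [G3, F3, h]

namespace Trans3
variable [CharZero K]

theorem eval_F3_act (g : Trans3 K) (Φ : Model3 K) {x x' : Fin 3 → K}
    (hx : ∀ j, x j = ∑ i, g.N.1 i j * x' i) (h : eval x Φ.U = 0) :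
    eval x' (F3 (g.act Φ).U) = g.μ ^ 6 * g.N.1.det ^ 4 * eval x (F3 Φ.U) := by
  have h' : eval x' (g.act Φ).U = 0 := by rw [g.eval_act_U Φ hx, h, mul_zero]
  rw [eval_F3 h', eval_F3 h, g.eval_hessianCubic_act Φ hx]
  ring

/-- Since $192=16\cdot12$, the defect $12s$ of $b_2$ contributes exactly $-sF_3$ up to the common
factor. -/
theorem eval_G3_act (g : Trans3 K) (Φ : Model3 K) {x x' : Fin 3 → K}
    (hx : ∀ j, x j = ∑ i, g.N.1 i j * x' i) (h : eval x Φ.U = 0) {s : K}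
    (hs : b2Cubic (g.act Φ).U = g.μ ^ 2 * (g.N.1.det ^ 2 * b2Cubic Φ.U + 12 * s)) :
    eval x' (G3 (g.act Φ).U) = g.μ ^ 8 * g.N.1.det ^ 4 *
      (g.N.1.det ^ 2 * eval x (G3 Φ.U) - s * eval x (F3 Φ.U)) := by
  have h' : eval x' (g.act Φ).U = 0 := by rw [g.eval_act_U Φ hx, h, mul_zero]
  rw [eval_G3 h', eval_G3 h, g.eval_thetaCubic_act Φ hx, g.eval_F3_act Φ hx h, hs]
  ring

end Trans3

end

/-- In the diagonal case the factors are $\mu^6d^4$ and $\mu^8d^6$ with $d=\det N$ and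
$|\mu|=|d|^{-1}$: both have absolute value $|d|^{-2}$. -/
theorem Model3.maxFG_act {K : Type*} [NormedField K] [IsUltrametricDist K] [CharZero K]
    {abv : AbsoluteValue K ℝ} (habv : ∀ a b : K, abv a ≤ abv b ↔ ‖a‖ ≤ ‖b‖)
    (Φ : Model3 (ringOfInts K)) (g : Trans3 K)
    (hg : g.IsIntegral ∨ (IsIntegerUnit g.det ∧ g.IsDiagonal)) {x x' : Fin 3 → K}
    (hx : ∀ j, x j = ∑ i, g.N.1 i j * x' i) (h : eval x Φ.toField.U = 0) :
    (g.act Φ.toField).maxFG abv x' = abv g.N.1.det ^ (-2 : ℤ) * Φ.toField.maxFG abv x := by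
  rcases hg with ⟨g₀, rfl⟩ | ⟨hu, hd⟩
  · have hμ : abv ((g₀.map (ringOfInts K).subtype).μ : K) = 1 := abv_unit_eq_one habv g₀.μ
    have hδ : abv (g₀.map (ringOfInts K).subtype).N.1.det = 1 := abv_det_map_eq_one habv g₀.N
    obtain ⟨s, hsm, hs⟩ := (g₀.map (ringOfInts K).subtype).exists_b2Cubic_act Φ.toField
      (ringOfInts K) (fun i j => (g₀.N.1 i j).2) fun i j k => by
        rw [toField, map, coeff3, coeff_map]; exact Subtype.property _
    rw [maxFG, maxFG, Trans3.eval_F3_act _ _ hx h, Trans3.eval_G3_act _ _ hx h hs,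
      max_abv_mul_sub habv _ _ _ hsm, hδ, one_zpow, one_mul]
    all_goals simp only [map_mul, map_pow, hμ, hδ, one_pow, mul_one]
  · have h1 := abv_eq_one_of_isIntegerUnit habv hu
    rw [Trans3.det, map_mul] at h1
    have h2 : abv (g.μ : K) = (abv g.N.1.det)⁻¹ := eq_inv_of_mul_eq_one_left h1
    have h3 : abv g.N.1.det ≠ 0 := right_ne_zero_of_mul_eq_one h1
    have hs : b2Cubic (g.act Φ.toField).U =
        g.μ ^ 2 * (g.N.1.det ^ 2 * b2Cubic Φ.toField.U + 12 * 0) := by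
      rw [Trans3.b2Cubic_act_of_isDiagonal hd, mul_zero, add_zero]
    rw [maxFG, maxFG, Trans3.eval_F3_act _ _ hx h, Trans3.eval_G3_act _ _ hx h hs,
      mul_max_of_nonneg _ _ (by positivity)]
    simp only [map_mul, map_pow, zero_mul, sub_zero, h2]
    congr 1 <;> field_simp

theorem Trans3.map_act {R S : Type*} [CommRing R] [CommRing S] (φ : R →+* S) (g : Trans3 R)
    (Φ : Model3 R) : (g.act Φ).map φ = (g.map φ).act (Φ.map φ) := by
  simp [Model3.map, act, map_linSubst, Trans3.map]

theorem Trans3.isPoint_act_iff {K : Type*} [Field K] (g : Trans3 K) (Φ : Model3 K)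
    {x x' : Fin 3 → K} (hx : ∀ j, x j = ∑ i, g.N.1 i j * x' i) :
    (g.act Φ).IsPoint x' ↔ Φ.IsPoint x := by
  rw [Model3.IsPoint, Model3.IsPoint, g.eval_act_U Φ hx, Ne, Ne,
    eq_zero_iff_of_eq_sum_mul g.N hx, mul_eq_zero, or_iff_right g.μ.ne_zero]

theorem Model3.tamagawaDistances_eq {K : Type*} [NormedField K] [IsUltrametricDist K]
    [CharZero K] {abv : AbsoluteValue K ℝ}
    (habv : ∀ a b : K, abv a ≤ abv b ↔ ‖a‖ ≤ ‖b‖) (π : K) {Φ Φ' : Model3 (ringOfInts K)}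
    (h : Φ.Equivalent Φ') :
    Φ.toField.tamagawaDistances abv π = Φ'.toField.tamagawaDistances abv π := by
  obtain ⟨g₀, rfl⟩ := h
  have hact : (g₀.act Φ).toField = (g₀.map (ringOfInts K).subtype).act Φ.toField :=
    Trans3.map_act _ _ _
  set g := g₀.map (ringOfInts K).subtype with hg
  have hmax : ∀ x x' : Fin 3 → K, (∀ j, x j = ∑ i, g.N.1 i j * x' i) → Φ.toField.IsPoint x →
      (g.act Φ.toField).maxFG abv x' / maxCoord abv x' ^ (2 * 3) =
        Φ.toField.maxFG abv x / maxCoord abv x ^ (2 * 3) := by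
    intro x x' hx hp
    rw [maxFG_act habv Φ g (Or.inl ⟨g₀, rfl⟩) hx hp.2, hg]
    change abv (Matrix.GeneralLinearGroup.map (ringOfInts K).subtype g₀.N).1.det ^ _ * _ / _ = _
    rw [abv_det_map_eq_one habv, one_zpow, one_mul, ← maxCoord_eq_of_integral habv g₀.N x',
      funext hx]
    rfl
  rw [hact]
  ext α
  constructor
  · rintro ⟨x, hp, hα⟩
    obtain ⟨x', hx⟩ := exists_eq_sum_mul g.N x
    exact ⟨x', (g.isPoint_act_iff _ hx).2 hp, by rw [hmax x x' hx hp, hα]⟩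
  · rintro ⟨x', hp, hα⟩
    have hp' := (g.isPoint_act_iff _ fun _ => rfl).1 hp
    exact ⟨_, hp', by rw [← hmax _ x' (fun _ => rfl) hp', hα]⟩

/-! ### Linear algebra of pairs of `4 × 4` matrices -/

section Adjugate

theorem exists_det_pencil_three {R : Type*} [CommRing R] (A B : Matrix (Fin 3) (Fin 3) R) :
    ∃ p q : R, ∀ c d : R, (c • A + d • B).det =
      c ^ 3 * A.det + c ^ 2 * d * p + c * d ^ 2 * q + d ^ 3 * B.det := by
  -- By multilinearity in the rows, `p` collects the determinants with one row of `A` replaced by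
  -- that of `B`, and `q` those with two.
  refine ⟨Matrix.det !![B 0 0, B 0 1, B 0 2; A 1 0, A 1 1, A 1 2; A 2 0, A 2 1, A 2 2]
      + Matrix.det !![A 0 0, A 0 1, A 0 2; B 1 0, B 1 1, B 1 2; A 2 0, A 2 1, A 2 2]
      + Matrix.det !![A 0 0, A 0 1, A 0 2; A 1 0, A 1 1, A 1 2; B 2 0, B 2 1, B 2 2],
    Matrix.det !![A 0 0, A 0 1, A 0 2; B 1 0, B 1 1, B 1 2; B 2 0, B 2 1, B 2 2]
      + Matrix.det !![B 0 0, B 0 1, B 0 2; A 1 0, A 1 1, A 1 2; B 2 0, B 2 1, B 2 2]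
      + Matrix.det !![B 0 0, B 0 1, B 0 2; B 1 0, B 1 1, B 1 2; A 2 0, A 2 1, A 2 2], ?_⟩
  intro c d
  simp [Matrix.det_fin_three]
  ring

/-- The entries of the adjugate are $3\times3$ minors up to sign, hence binary cubics in $(c,d)$. -/
theorem exists_adjugate_pencil {R : Type*} [CommRing R] (A B : Matrix (Fin 4) (Fin 4) R) :
    ∃ X Y : Matrix (Fin 4) (Fin 4) R, ∀ c d : R, (c • A + d • B).adjugate =
      c ^ 3 • A.adjugate + (c ^ 2 * d) • X + (c * d ^ 2) • Y + d ^ 3 • B.adjugate := by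
  have h : ∀ i j : Fin 4, ∃ p q : R, ∀ c d : R, (c • A + d • B).adjugate i j =
      c ^ 3 * A.adjugate i j + c ^ 2 * d * p + c * d ^ 2 * q + d ^ 3 * B.adjugate i j := by
    intro i j
    obtain ⟨p, q, h⟩ := exists_det_pencil_three (A.submatrix j.succAbove i.succAbove)
      (B.submatrix j.succAbove i.succAbove)
    refine ⟨(-1) ^ (j + i : ℕ) * p, (-1) ^ (j + i : ℕ) * q, fun c d => ?_⟩
    have h' := h c d
    simp only [Matrix.adjugate_fin_succ_eq_det_submatrix, Matrix.submatrix_add,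
      Matrix.submatrix_smul, Pi.add_apply, Pi.smul_apply] at h' ⊢
    rw [h']
    ring
  choose X Y h using h
  refine ⟨Matrix.of X, Matrix.of Y, fun c d => ?_⟩
  ext i j
  simpa using h i j c d

/-- The coefficients of `adj (c A + d B)`, and the relations between them coming from
`C adj C = adj C C = det C`. -/
theorem exists_adjugate_pencil_mul {K : Type*} [Field K] [CharZero K]
    (A B : Matrix (Fin 4) (Fin 4) K) :
    ∃ X Y : Matrix (Fin 4) (Fin 4) K, ∃ e₁ e₂ e₃ : K,
      (∀ c d : K, (c • A + d • B).adjugate =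
        c ^ 3 • A.adjugate + (c ^ 2 * d) • X + (c * d ^ 2) • Y + d ^ 3 • B.adjugate) ∧
      (A * X + B * A.adjugate = e₁ • 1 ∧ X * A + A.adjugate * B = e₁ • 1) ∧
      (A * Y + B * X = e₂ • 1 ∧ Y * A + X * B = e₂ • 1) ∧
      (A * B.adjugate + B * Y = e₃ • 1 ∧ B.adjugate * A + Y * B = e₃ • 1) := by
  obtain ⟨X, Y, h⟩ := exists_adjugate_pencil A B
  have hl : ∀ c d : K, c ^ 4 • (A.det • (1 : Matrix (Fin 4) (Fin 4) K))
      + (c ^ 3 * d) • (A * X + B * A.adjugate) + (c ^ 2 * d ^ 2) • (A * Y + B * X)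
      + (c * d ^ 3) • (A * B.adjugate + B * Y) + d ^ 4 • (B.det • (1 : Matrix (Fin 4) (Fin 4) K))
      = (c • A + d • B).det • (1 : Matrix (Fin 4) (Fin 4) K) := by
    intro c d
    rw [← Matrix.mul_adjugate A, ← Matrix.mul_adjugate B, ← Matrix.mul_adjugate, h]
    simp only [mul_add, add_mul, Matrix.smul_mul, Matrix.mul_smul]
    module
  have hr : ∀ c d : K, c ^ 4 • (A.det • (1 : Matrix (Fin 4) (Fin 4) K))
      + (c ^ 3 * d) • (X * A + A.adjugate * B) + (c ^ 2 * d ^ 2) • (Y * A + X * B)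
      + (c * d ^ 3) • (B.adjugate * A + Y * B) + d ^ 4 • (B.det • (1 : Matrix (Fin 4) (Fin 4) K))
      = (c • A + d • B).det • (1 : Matrix (Fin 4) (Fin 4) K) := by
    intro c d
    rw [← Matrix.adjugate_mul A, ← Matrix.adjugate_mul B, ← Matrix.adjugate_mul, h]
    simp only [mul_add, add_mul, Matrix.smul_mul, Matrix.mul_smul]
    module
  set p := A.det
  set q := B.det
  set s := ((1 : K) • A + (1 : K) • B).det
  set t := ((1 : K) • A + (-1 : K) • B).det
  set u := ((1 : K) • A + (2 : K) • B).det
  -- These are the three middle coefficients of the quartic $\det(A+dB)$ in $d$, interpolated from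
  -- its values at $1,-1,2$ and its outer coefficients `p`, `q`. The same combinations of the matrix
  -- identities isolate the six relations.
  refine ⟨X, Y, s - t / 3 - u / 6 - p / 2 + 2 * q, (s + t) / 2 - p - q,
    u / 6 - s / 2 - t / 6 + p / 2 - 2 * q, h, ⟨?_, ?_⟩, ⟨?_, ?_⟩, ⟨?_, ?_⟩⟩
  · linear_combination (norm := module) hl 1 1 - (1 / 3 : K) • hl 1 (-1) - (1 / 6 : K) • hl 1 2
  · linear_combination (norm := module) hr 1 1 - (1 / 3 : K) • hr 1 (-1) - (1 / 6 : K) • hr 1 2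
  · linear_combination (norm := module) (1 / 2 : K) • hl 1 1 + (1 / 2 : K) • hl 1 (-1)
  · linear_combination (norm := module) (1 / 2 : K) • hr 1 1 + (1 / 2 : K) • hr 1 (-1)
  · linear_combination (norm := module) (1 / 6 : K) • hl 1 2 - (1 / 2 : K) • hl 1 1
      - (1 / 6 : K) • hl 1 (-1)
  · linear_combination (norm := module) (1 / 6 : K) • hr 1 2 - (1 / 2 : K) • hr 1 1
      - (1 / 6 : K) • hr 1 (-1)

/-- The behaviour of `xᵀ A adj(B) A x` under linear changes of a pair `(A, B)`. -/
theorem dotProduct_adjugate_pencil {K : Type*} [Field K] [CharZero K]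
    {A B : Matrix (Fin 4) (Fin 4) K} (hA : A.transpose = A) (hB : B.transpose = B)
    {x : Fin 4 → K} (hxA : x ⬝ᵥ A.mulVec x = 0) (hxB : x ⬝ᵥ B.mulVec x = 0) (a b c d : K) :
    ((a • A + b • B).mulVec x) ⬝ᵥ
        ((c • A + d • B).adjugate.mulVec ((a • A + b • B).mulVec x)) =
      (a * d - b * c) ^ 2 * (d * (A.mulVec x ⬝ᵥ B.adjugate.mulVec (A.mulVec x))
        + c * (B.mulVec x ⬝ᵥ A.adjugate.mulVec (B.mulVec x))) := by
  obtain ⟨X, Y, e₁, e₂, e₃, h, ⟨l1, r1⟩, ⟨l2, r2⟩, ⟨l3, r3⟩⟩ := exists_adjugate_pencil_mul A B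
  have hAl : ∀ (S : Matrix (Fin 4) (Fin 4) K) v,
      A.mulVec x ⬝ᵥ S.mulVec v = x ⬝ᵥ (A * S).mulVec v := fun S v => by
    rw [← Matrix.mulVec_mulVec, Matrix.dotProduct_mulVec x A, ← Matrix.mulVec_transpose, hA]
  have hBl : ∀ (S : Matrix (Fin 4) (Fin 4) K) v,
      B.mulVec x ⬝ᵥ S.mulVec v = x ⬝ᵥ (B * S).mulVec v := fun S v => by
    rw [← Matrix.mulVec_mulVec, Matrix.dotProduct_mulVec x B, ← Matrix.mulVec_transpose, hB]
  -- Pairing a relation with $x$ on one side turns it into a relation between values at $Ax$ and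
  -- $Bx$.
  have hl : ∀ (S T : Matrix (Fin 4) (Fin 4) K) (e : K) v, A * S + B * T = e • 1 →
      A.mulVec x ⬝ᵥ S.mulVec v + B.mulVec x ⬝ᵥ T.mulVec v = e * (x ⬝ᵥ v) := by
    intro S T e v hST
    rw [hAl, hBl, ← dotProduct_add, ← Matrix.add_mulVec, hST, Matrix.smul_mulVec,
      Matrix.one_mulVec, dotProduct_smul, smul_eq_mul]
  have hr : ∀ (S T : Matrix (Fin 4) (Fin 4) K) (e : K) v, S * A + T * B = e • 1 →
      v ⬝ᵥ S.mulVec (A.mulVec x) + v ⬝ᵥ T.mulVec (B.mulVec x) = e * (v ⬝ᵥ x) := by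
    intro S T e v hST
    rw [Matrix.mulVec_mulVec, Matrix.mulVec_mulVec, ← dotProduct_add, ← Matrix.add_mulVec, hST,
      Matrix.smul_mulVec, Matrix.one_mulVec, dotProduct_smul, smul_eq_mul]
  have hxA' : A.mulVec x ⬝ᵥ x = 0 := by rw [dotProduct_comm, hxA]
  have hxB' : B.mulVec x ⬝ᵥ x = 0 := by rw [dotProduct_comm, hxB]
  have l0 : ∀ v, A.mulVec x ⬝ᵥ A.adjugate.mulVec v = A.det * (x ⬝ᵥ v) := fun v => by
    simpa using hl A.adjugate 0 A.det v (by simp [Matrix.mul_adjugate])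
  have l4 : ∀ v, B.mulVec x ⬝ᵥ B.adjugate.mulVec v = B.det * (x ⬝ᵥ v) := fun v => by
    simpa using hl 0 B.adjugate B.det v (by simp [Matrix.mul_adjugate])
  have r0 : ∀ v, v ⬝ᵥ A.adjugate.mulVec (A.mulVec x) = A.det * (v ⬝ᵥ x) := fun v => by
    simpa using hr A.adjugate 0 A.det v (by simp [Matrix.adjugate_mul])
  have r4 : ∀ v, v ⬝ᵥ B.adjugate.mulVec (B.mulVec x) = B.det * (v ⬝ᵥ x) := fun v => by
    simpa using hr 0 B.adjugate B.det v (by simp [Matrix.adjugate_mul])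
  have a1 := hl _ _ _ (A.mulVec x) l1
  have a2 := hl _ _ _ (B.mulVec x) l1
  have a3 := hr _ _ _ (B.mulVec x) r1
  have a4 := hl _ _ _ (A.mulVec x) l2
  have a5 := hl _ _ _ (B.mulVec x) l2
  have a6 := hl _ _ _ (A.mulVec x) l3
  have a7 := hl _ _ _ (B.mulVec x) l3
  have a8 := hr _ _ _ (A.mulVec x) r3
  have b1 := l0 (A.mulVec x)
  have b2 := l0 (B.mulVec x)
  have b3 := r0 (B.mulVec x)
  have b4 := l4 (A.mulVec x)
  have b5 := l4 (B.mulVec x)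
  have b6 := r4 (A.mulVec x)
  rw [h]
  simp only [Matrix.add_mulVec, Matrix.smul_mulVec, Matrix.mulVec_add, Matrix.mulVec_smul,
    add_dotProduct, dotProduct_add, smul_dotProduct, dotProduct_smul, smul_eq_mul]
  -- For $v=Ax$ or $Bx$ every right side is a multiple of $x^{T}Ax$ or $x^{T}Bx$ and vanishes. The
  -- scalars `e₁`, `e₂`, `e₃` thus disappear, and all values reduce to the two that appear in the
  -- conclusion.
  simp only [hxA, hxB, hxA', hxB', mul_zero] at a1 a2 a3 a4 a5 a6 a7 a8 b1 b2 b3 b4 b5 b6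
  generalize A.mulVec x = α at *
  generalize B.mulVec x = β at *
  have c1 : α ⬝ᵥ X.mulVec α = 0 := by linear_combination a1 - b3
  have c2 : α ⬝ᵥ X.mulVec β = -(β ⬝ᵥ A.adjugate.mulVec β) := by linear_combination a2
  have c3 : β ⬝ᵥ X.mulVec α = -(β ⬝ᵥ A.adjugate.mulVec β) := by linear_combination a3
  have c4 : β ⬝ᵥ X.mulVec β = α ⬝ᵥ B.adjugate.mulVec α := by linear_combination a5 - a8
  have c5 : α ⬝ᵥ Y.mulVec α = β ⬝ᵥ A.adjugate.mulVec β := by linear_combination a4 - c3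
  have c6 : α ⬝ᵥ Y.mulVec β = -(α ⬝ᵥ B.adjugate.mulVec α) := by linear_combination a8
  have c7 : β ⬝ᵥ Y.mulVec α = -(α ⬝ᵥ B.adjugate.mulVec α) := by linear_combination a6
  have c8 : β ⬝ᵥ Y.mulVec β = 0 := by linear_combination a7 - b6
  rw [c1, c2, c3, c4, c5, c6, c7, c8, b1, b2, b3, b4, b5, b6]
  ring

end Adjugate

section Pfaffian
variable {R : Type*} [CommRing R]

/-- `pf = c₁₂ c₃₄ + c₁₃ c₂₄ + c₁₄ c₂₃` for the quadric with matrix of second derivatives `A`. -/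
def pf (A : Matrix (Fin 4) (Fin 4) R) : R := A 0 1 * A 2 3 + A 0 2 * A 1 3 + A 0 3 * A 1 2

/-- The Pfaffian of `N A Nᵀ` for an alternating `4 × 4` matrix `A`. -/
theorem pfaffian_conj (N A : Matrix (Fin 4) (Fin 4) R) (h0 : ∀ i, A i i = 0)
    (hA : ∀ i j, A j i = -A i j) :
    let B := N * A * N.transpose
    B 0 1 * B 2 3 - B 0 2 * B 1 3 + B 0 3 * B 1 2 =
      N.det * (A 0 1 * A 2 3 - A 0 2 * A 1 3 + A 0 3 * A 1 2) := by
  intro B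
  have hB : ∀ i j, B i j =
      A 0 1 * (N i 0 * N j 1 - N i 1 * N j 0) + A 0 2 * (N i 0 * N j 2 - N i 2 * N j 0)
      + A 0 3 * (N i 0 * N j 3 - N i 3 * N j 0) + A 1 2 * (N i 1 * N j 2 - N i 2 * N j 1)
      + A 1 3 * (N i 1 * N j 3 - N i 3 * N j 1) + A 2 3 * (N i 2 * N j 3 - N i 3 * N j 2) := by
    intro i j
    simp only [B, Matrix.mul_apply, Matrix.transpose_apply, Fin.sum_univ_four, h0, hA 0 1, hA 0 2,
      hA 0 3, hA 1 2, hA 1 3, hA 2 3]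
    ring
  -- Laplace expansion along the first two rows, to match the $2\times2$ minors in `hB`.
  have hdet : N.det = (N 0 0 * N 1 1 - N 0 1 * N 1 0) * (N 2 2 * N 3 3 - N 2 3 * N 3 2)
      - (N 0 0 * N 1 2 - N 0 2 * N 1 0) * (N 2 1 * N 3 3 - N 2 3 * N 3 1)
      + (N 0 0 * N 1 3 - N 0 3 * N 1 0) * (N 2 1 * N 3 2 - N 2 2 * N 3 1)
      + (N 0 1 * N 1 2 - N 0 2 * N 1 1) * (N 2 0 * N 3 3 - N 2 3 * N 3 0)
      - (N 0 1 * N 1 3 - N 0 3 * N 1 1) * (N 2 0 * N 3 2 - N 2 2 * N 3 0)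
      + (N 0 2 * N 1 3 - N 0 3 * N 1 2) * (N 2 0 * N 3 1 - N 2 1 * N 3 0) := by
    rw [Matrix.det_succ_row_zero]
    simp [Fin.sum_univ_succ, Matrix.det_fin_three, Fin.succAbove]
    ring
  rw [hB, hB, hB, hB, hB, hB, hdet]
  ring

/-- Modulo 2 signs do not matter: `A` becomes alternating and `pf` its Pfaffian, which conjugation
by `N` multiplies by `det N`. -/
theorem exists_pf_conj (N A : Matrix (Fin 4) (Fin 4) R) (hA : A.transpose = A)
    (hd : ∀ i, 2 ∣ A i i) : ∃ w : R, pf (N * A * N.transpose) = N.det * pf A + 2 * w := by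
  let π : R →+* R ⧸ Ideal.span {(2 : R)} := Ideal.Quotient.mk _
  have h2 : (2 : R ⧸ Ideal.span {(2 : R)}) = 0 := by
    rw [← map_ofNat π, Ideal.Quotient.eq_zero_iff_mem]
    exact Ideal.mem_span_singleton_self _
  have hneg : ∀ z : R ⧸ Ideal.span {(2 : R)}, -z = z := fun z => by linear_combination -z * h2
  have h := pfaffian_conj (N.map π) (A.map π)
    (fun i => by
      rw [Matrix.map_apply, Ideal.Quotient.eq_zero_iff_mem]
      exact Ideal.mem_span_singleton.2 (hd i))
    (fun i j => by rw [hneg, Matrix.map_apply, Matrix.map_apply, ← Matrix.transpose_apply A, hA])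
  have hm : N.map π * A.map π * (N.map π).transpose = (N * A * N.transpose).map π := by
    rw [Matrix.map_mul, Matrix.map_mul, Matrix.transpose_map]
  have hdet : (N.map π).det = π N.det := (RingHom.map_det π N).symm
  simp only [hm, hdet, Matrix.map_apply, sub_eq_add_neg, hneg] at h
  simp only [← map_add, ← map_mul, Ideal.Quotient.eq, Ideal.mem_span_singleton, π] at h
  obtain ⟨w, hw⟩ := h
  exact ⟨w, by rw [pf, pf]; linear_combination hw⟩

/-- This makes $\mathrm{rd}$ integral although it is defined by a division by 4. With zero diagonal
and $u,v,w$ the three products in $\mathrm{pf}$, the determinant is $(u+v+w)^2-4(uv+uw+vw)$; the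
even diagonal entries add only multiples of 4. -/
theorem exists_det_eq_pf_sq_add (A : Matrix (Fin 4) (Fin 4) R) (hA : A.transpose = A)
    (hd : ∀ i, 2 ∣ A i i) : ∃ w : R, A.det = pf A ^ 2 + 4 * w := by
  choose a ha using hd
  have hs : ∀ i j, A j i = A i j := fun i j => by rw [← Matrix.transpose_apply A, hA]
  refine ⟨4 * a 0 * a 1 * a 2 * a 3 - a 0 * a 1 * A 2 3 ^ 2 - a 0 * a 2 * A 1 3 ^ 2
    - a 0 * a 3 * A 1 2 ^ 2 - a 1 * a 2 * A 0 3 ^ 2 - a 1 * a 3 * A 0 2 ^ 2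
    - a 2 * a 3 * A 0 1 ^ 2 + a 0 * A 1 2 * A 1 3 * A 2 3 + a 1 * A 0 2 * A 0 3 * A 2 3
    + a 2 * A 0 1 * A 0 3 * A 1 3 + a 3 * A 0 1 * A 0 2 * A 1 2
    - A 0 1 * A 2 3 * A 0 2 * A 1 3 - A 0 1 * A 2 3 * A 0 3 * A 1 2
    - A 0 2 * A 1 3 * A 0 3 * A 1 2, ?_⟩
  rw [Matrix.det_succ_row_zero]
  simp [Fin.sum_univ_succ, Matrix.det_fin_three, Fin.succAbove, pf, ha, hs 0 1, hs 0 2, hs 0 3,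
    hs 1 2, hs 1 3, hs 2 3]
  ring

end Pfaffian

/-! ### Degree 4 -/

section Gram
variable {R : Type*} [CommRing R] {n : ℕ}

theorem hessianAt_transpose (f : MvPolynomial (Fin n) R) (x : Fin n → R) :
    (hessianAt f x).transpose = hessianAt f x := by
  ext i j
  have h : pderiv i (pderiv j f) = pderiv j (pderiv i f) := by
    ext m
    simp only [coeff_pderiv]
    by_cases hij : i = j
    · subst hij; rfl
    · have hji : j ≠ i := fun h => hij h.symm
      simp only [Finsupp.add_apply, Finsupp.single_apply, if_neg hij, if_neg hji, add_zero,
        add_right_comm m (Finsupp.single i 1)]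
      ring
  simp [hessianAt, hessianMatrix, h]

theorem hessianAt_map {S : Type*} [CommRing S] (φ : R →+* S) (f : MvPolynomial (Fin n) R) :
    hessianAt (MvPolynomial.map φ f) 0 = (hessianAt f 0).map φ := by
  ext i j
  simp [hessianAt, hessianMatrix, pderiv_map, constantCoeff_map]

theorem two_dvd_hessianAt_zero (f : MvPolynomial (Fin n) R) (i : Fin n) :
    2 ∣ hessianAt f 0 i i := by
  have h : hessianAt f 0 i i = coeff 0 (pderiv i (pderiv i f)) := by
    simp [hessianAt, hessianMatrix, constantCoeff_eq]
  rw [h, coeff_pderiv, coeff_pderiv]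
  refine ⟨coeff (0 + Finsupp.single i 1 + Finsupp.single i 1) f, ?_⟩
  simp
  ring

theorem hessianAt_add (f g : MvPolynomial (Fin n) R) (x : Fin n → R) :
    hessianAt (f + g) x = hessianAt f x + hessianAt g x := by
  ext i j
  simp [hessianAt, hessianMatrix]

/-- A quadratic form in terms of its matrix of second derivatives. -/
theorem two_mul_eval_of_isHomogeneous_two {f : MvPolynomial (Fin n) R} (hf : f.IsHomogeneous 2)
    (x : Fin n → R) : 2 * eval x f = x ⬝ᵥ (hessianAt f 0).mulVec x := by
  -- Euler's identity, for `f` and then for its linear partial derivatives; second derivatives are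
  -- constants, so they may be read off at 0.
  have h1 := congrArg (eval x) hf.sum_X_mul_pderiv
  have h2 : ∀ i, eval x (pderiv i f) = ∑ j, hessianAt f 0 i j * x j := by
    intro i
    have h3 := congrArg (eval x) (hf.pderiv (i := i)).sum_X_mul_pderiv
    have h4 : ∀ j, eval x (pderiv j (pderiv i f)) = hessianAt f 0 j i := fun j => by
      have h5 := ((hf.pderiv (i := i)).pderiv (i := j))
      rw [show 2 - 1 - 1 = 0 from rfl, ← totalDegree_zero_iff_isHomogeneous,
        totalDegree_eq_zero_iff_eq_C] at h5
      rw [hessianAt, Matrix.map_apply, hessianMatrix, Matrix.of_apply, h5, eval_C, eval_C]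
    simp only [map_sum, map_mul, eval_X, h4, map_nsmul] at h3
    rw [show 2 - 1 = 1 from rfl, one_nsmul] at h3
    rw [← h3]
    refine Finset.sum_congr rfl fun j _ => ?_
    rw [← congrFun (congrFun (hessianAt_transpose f 0) i) j, Matrix.transpose_apply, mul_comm]
  simp only [map_sum, map_mul, eval_X, h2, nsmul_eq_mul, Nat.cast_ofNat, map_ofNat] at h1
  rw [← h1]
  rfl

end Gram

section
variable {K : Type*} [Field K]

theorem gramMatrix_eq_hessianAt (f : MvPolynomial (Fin 4) K) :
    gramMatrix f = hessianAt f 0 := by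
  ext i j
  simp [gramMatrix, hessianAt]

theorem gramMatrix_act (g : Trans4 K) (Φ : Model4 K) (i : Fin 2) :
    gramMatrix ((g.act Φ).Q i) = g.N.1 *
      (g.M.1 i 0 • gramMatrix (Φ.Q 0) + g.M.1 i 1 • gramMatrix (Φ.Q 1)) * g.N.1.transpose := by
  have h0 : (fun j => ∑ i, g.N.1 i j * (0 : Fin 4 → K) i) = 0 := by ext; simp
  simp only [gramMatrix_eq_hessianAt]
  rw [Trans4.act, hessianAt_linSubst, h0, Fin.sum_univ_two, hessianAt_add, hessianAt_C_mul,
    hessianAt_C_mul]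

theorem gramMatrix_transpose (f : MvPolynomial (Fin 4) K) :
    (gramMatrix f).transpose = gramMatrix f := by
  rw [gramMatrix_eq_hessianAt, hessianAt_transpose]

variable [CharZero K]

/-- The quadrics `T₁`, `T₂` at a point of `Q₁ = 0`. -/
theorem eval_covT {A B : Matrix (Fin 4) (Fin 4) K} (hA : A.transpose = A) (hB : B.transpose = B)
    {x : Fin 4 → K} (hx : x ⬝ᵥ A.mulVec x = 0) :
    eval x (covT A B) = -(1 / 2) * (A.mulVec x ⬝ᵥ B.adjugate.mulVec (A.mulVec x)) := by
  have hD : B.adjugate.transpose = B.adjugate := by rw [Matrix.adjugate_transpose, hB]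
  have hsymm : ∀ i j, A j i = A i j := fun i j => by rw [← Matrix.transpose_apply A, hA]
  have hDs : ∀ i j, B.adjugate j i = B.adjugate i j := fun i j => by
    rw [← Matrix.transpose_apply B.adjugate, hD]
  -- Summing over $i,j$ first, the term with $A_{ij}A_{rs}$ gives $A_{rs}\,x^{T}Ax=0$, and only the
  -- product of two coordinates of $Ax$ remains.
  have hw : ∀ r s, ∑ i, ∑ j, (A i j * A r s - A i s * A j r) * (x i * x j) =
      -(A.mulVec x r * A.mulVec x s) := by
    intro r s
    have h1 : ∑ i, ∑ j, A i j * (x i * x j) = 0 := by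
      rw [← hx]
      simp only [dotProduct, Matrix.mulVec, Finset.mul_sum]
      exact Finset.sum_congr rfl fun i _ => Finset.sum_congr rfl fun j _ => by ring
    have h2 : A.mulVec x r * A.mulVec x s = ∑ i, ∑ j, A i s * A j r * (x i * x j) := by
      simp only [dotProduct, Matrix.mulVec, Finset.sum_mul_sum]
      rw [Finset.sum_comm]
      refine Finset.sum_congr rfl fun i _ => Finset.sum_congr rfl fun j _ => ?_
      rw [hsymm i s, hsymm j r]
      ring
    have h3 : ∑ i, ∑ j, (A i j * A r s - A i s * A j r) * (x i * x j) =
        A r s * ∑ i, ∑ j, A i j * (x i * x j) - ∑ i, ∑ j, A i s * A j r * (x i * x j) := by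
      simp only [Finset.mul_sum, ← Finset.sum_sub_distrib]
      exact Finset.sum_congr rfl fun i _ => Finset.sum_congr rfl fun j _ => by ring
    rw [h3, h1, h2]
    ring
  have hsum : eval x (covT A B) = ∑ r, ∑ s, if r ≤ s then
      dualCoeff B r s * -(A.mulVec x r * A.mulVec x s) else 0 := by
    have h1 : eval x (covT A B) = ∑ i, ∑ j, ∑ r, ∑ s, (if r ≤ s then
        dualCoeff B r s * ((A i j * A r s - A i s * A j r) * (x i * x j)) else 0) := by
      simp only [covT, map_sum, map_mul, eval_C, eval_X, Finset.sum_mul, ite_mul, zero_mul,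
        mul_assoc]
    rw [h1]
    rw [Finset.sum_congr rfl fun i _ => Finset.sum_comm, Finset.sum_comm]
    refine Finset.sum_congr rfl fun r _ => ?_
    rw [Finset.sum_congr rfl fun i _ => Finset.sum_comm, Finset.sum_comm]
    refine Finset.sum_congr rfl fun s _ => ?_
    split_ifs
    · simp only [← Finset.mul_sum, hw]
    · simp
  rw [hsum]
  generalize A.mulVec x = y
  -- A sum over $r\le s$ with halved diagonal coefficients is half of the full symmetric sum, whence
  -- the factor $1/2$.
  simp only [dualCoeff, dotProduct, Matrix.mulVec, Fin.sum_univ_four, hDs 0 1, hDs 0 2, hDs 0 3,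
    hDs 1 2, hDs 1 3, hDs 2 3]
  simp +decide
  ring

end

/-! ### Degree 4: the pencil and its binary quartic. -/

section Pencil
variable {R : Type*} [CommRing R]

/-- The matrix `x A + z B` over `R[x, z]`. -/
def pencilMatrix (A B : Matrix (Fin 4) (Fin 4) R) :
    Matrix (Fin 4) (Fin 4) (MvPolynomial (Fin 2) R) :=
  Matrix.of fun i j => C (A i j) * X 0 + C (B i j) * X 1

/-- Changing the basis of the pencil by `M` is a substitution in $(x,z)$, so `M` takes the role that
the matrix `N` has in degree 2. -/
theorem pencilMatrix_conj (M : Matrix (Fin 2) (Fin 2) R) (N A B : Matrix (Fin 4) (Fin 4) R) :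
    pencilMatrix (N * (M 0 0 • A + M 0 1 • B) * N.transpose)
        (N * (M 1 0 • A + M 1 1 • B) * N.transpose) =
      (N.map C * pencilMatrix A B * (N.map C).transpose).map (linSubst M) := by
  ext1 i j
  simp only [pencilMatrix, Matrix.mul_apply, Matrix.map_apply, Matrix.transpose_apply,
    Matrix.of_apply, Matrix.add_apply, Matrix.smul_apply, smul_eq_mul, Fin.sum_univ_four,
    linSubst, map_add, map_mul, aeval_X, Fin.sum_univ_two, aeval_C, algebraMap_eq]
  ring

theorem pencilMatrix_map {S : Type*} [CommRing S] (φ : R →+* S)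
    (A B : Matrix (Fin 4) (Fin 4) R) :
    pencilMatrix (A.map φ) (B.map φ) = (pencilMatrix A B).map (MvPolynomial.map φ) := by
  ext1 i j
  simp [pencilMatrix]

theorem pencilMatrix_isHomogeneous (A B : Matrix (Fin 4) (Fin 4) R) (i j : Fin 4) :
    (pencilMatrix A B i j).IsHomogeneous 1 :=
  (isHomogeneous_C_mul_X _ _).add (isHomogeneous_C_mul_X _ _)

theorem pf_isHomogeneous {P : Matrix (Fin 4) (Fin 4) (MvPolynomial (Fin 2) R)}
    (hP : ∀ i j, (P i j).IsHomogeneous 1) : (pf P).IsHomogeneous 2 :=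
  (((hP _ _).mul (hP _ _)).add ((hP _ _).mul (hP _ _))).add ((hP _ _).mul (hP _ _))

theorem det_isHomogeneous {P : Matrix (Fin 4) (Fin 4) (MvPolynomial (Fin 2) R)}
    (hP : ∀ i j, (P i j).IsHomogeneous 1) : P.det.IsHomogeneous 4 := by
  rw [Matrix.det_apply]
  refine IsHomogeneous.sum _ _ _ fun σ _ => ?_
  have h : (∏ i, P (σ i) i).IsHomogeneous (∑ _i : Fin 4, 1) :=
    IsHomogeneous.prod _ _ _ fun i _ => hP _ _
  rw [Units.smul_def, zsmul_eq_mul, ← map_intCast (C : R →+* MvPolynomial (Fin 2) R)]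
  exact h.C_mul _

theorem map_pf {S : Type*} [CommRing S] (φ : R →+* S) (A : Matrix (Fin 4) (Fin 4) R) :
    pf (A.map φ) = φ (pf A) := by
  simp [pf]

end Pencil

section
variable {K : Type*} [Field K]

theorem pencil_eq (Q : Fin 2 → MvPolynomial (Fin 4) K) :
    pencil Q = pencilMatrix (gramMatrix (Q 0)) (gramMatrix (Q 1)) := rfl

theorem pfPencil_isHomogeneous (Q : Fin 2 → MvPolynomial (Fin 4) K) :
    (pfPencil Q).IsHomogeneous 2 :=
  pf_isHomogeneous (pencilMatrix_isHomogeneous _ _)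

/-- The binary quartic `(pf, rd)(x Q₁ + z Q₂)`. -/
def Model4.toModel2 (Φ : Model4 K) : Model2 K where
  P := pfPencil Φ.Q
  Q := rdPencil Φ.Q
  hP := pfPencil_isHomogeneous _
  hQ := ((det_isHomogeneous (pencilMatrix_isHomogeneous _ _)).sub
    ((pfPencil_isHomogeneous Φ.Q).pow 2)).C_mul _

namespace Trans4

/-- The change of `y` in the binary quartic `(pf, rd)(x Q₁ + z Q₂)`. -/
def pfShift (g : Trans4 K) (Φ : Model4 K) : MvPolynomial (Fin 2) K :=
  C (1 / (2 * g.N.1.det)) * (pf (g.N.1.map C * pencil Φ.Q * (g.N.1.map C).transpose)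
    - C g.N.1.det * pfPencil Φ.Q)

theorem pfShift_isHomogeneous (g : Trans4 K) (Φ : Model4 K) :
    (g.pfShift Φ).IsHomogeneous 2 := by
  refine ((pf_isHomogeneous fun i j => ?_).sub
    ((pfPencil_isHomogeneous _).C_mul _)).C_mul _
  simp only [Matrix.mul_apply, Finset.sum_mul, Matrix.map_apply, Matrix.transpose_apply]
  refine IsHomogeneous.sum _ _ _ fun k _ => IsHomogeneous.sum _ _ _ fun l _ => ?_
  rw [mul_comm]
  exact ((pencilMatrix_isHomogeneous _ _ _ _).C_mul _).C_mul _

/-- The transformation induced on the binary quartic `(pf, rd)(x Q₁ + z Q₂)`. -/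
def toTrans2 (g : Trans4 K) (Φ : Model4 K) : Trans2 K where
  μ := Matrix.GeneralLinearGroup.det g.N
  r := ![coeff2 (g.pfShift Φ) 2 0, coeff2 (g.pfShift Φ) 1 1, coeff2 (g.pfShift Φ) 0 2]
  N := g.M

theorem rForm_toTrans2 (g : Trans4 K) (Φ : Model4 K) :
    (g.toTrans2 Φ).rForm = g.pfShift Φ := by
  conv_rhs => rw [eq_of_isHomogeneous_two (g.pfShift_isHomogeneous Φ)]
  simp [Trans2.rForm, toTrans2]

theorem det_ne_zero (g : Trans4 K) : g.N.1.det ≠ 0 :=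
  (Matrix.GeneralLinearGroup.det g.N).ne_zero

theorem pencil_act (g : Trans4 K) (Φ : Model4 K) :
    pencil (g.act Φ).Q = (g.N.1.map C * pencil Φ.Q * (g.N.1.map C).transpose).map
      (linSubst g.M.1) := by
  rw [pencil_eq, gramMatrix_act, gramMatrix_act, pencilMatrix_conj]
  rfl

variable [CharZero K]

/-- Put $d=\det N$. `pfShift` is the solution $\rho$ of $\mathrm{pf}(NPN^{T})=d(\mathrm{pf}+2\rho)$,
with $P$ the pencil. Since $\det=\mathrm{pf}^2+4\,\mathrm{rd}$ is multiplied by $d^2$, the form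
$\mathrm{rd}$ must become $d^2(\mathrm{rd}-\rho\,\mathrm{pf}-\rho^2)$, as for a degree 2
transformation with $\mu=d$. -/
theorem toModel2_act (g : Trans4 K) (Φ : Model4 K) :
    (g.act Φ).toModel2 = (g.toTrans2 Φ).act Φ.toModel2 := by
  have hδ := g.det_ne_zero
  have h2 : (C 2 : MvPolynomial (Fin 2) K) = 2 := map_ofNat C 2
  have h22 : C (1 / (2 * g.N.1.det)) * (C 2 * C g.N.1.det) = (1 : MvPolynomial (Fin 2) K) := by
    rw [← C_mul, ← C_mul, ← C_1]
    congr 1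
    field_simp
  have hpf : pf (g.N.1.map C * pencil Φ.Q * (g.N.1.map C).transpose) =
      C g.N.1.det * (pfPencil Φ.Q + C 2 * g.pfShift Φ) := by
    rw [pfShift]
    linear_combination -(pf (g.N.1.map C * pencil Φ.Q * (g.N.1.map C).transpose)
      - C g.N.1.det * pfPencil Φ.Q) * h22
  have hP : pfPencil (g.act Φ).Q =
      linSubst g.M.1 (C g.N.1.det * (pfPencil Φ.Q + C 2 * g.pfShift Φ)) := by
    rw [← hpf]
    change pf (pencil (g.act Φ).Q) = _
    rw [pencil_act]
    exact map_pf (aeval _ : MvPolynomial (Fin 2) K →ₐ[K] MvPolynomial (Fin 2) K).toRingHom _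
  have hdet : (pencil (g.act Φ).Q).det = linSubst g.M.1 (C (g.N.1.det ^ 2) * (pencil Φ.Q).det) := by
    have h3 : (g.N.1.map C).det = (C g.N.1.det : MvPolynomial (Fin 2) K) :=
      (RingHom.map_det C g.N.1).symm
    have h4 : C (g.N.1.det ^ 2) * (pencil Φ.Q).det =
        (g.N.1.map C * pencil Φ.Q * (g.N.1.map C).transpose).det := by
      rw [Matrix.det_mul, Matrix.det_mul, Matrix.det_transpose, h3, C_pow]
      ring
    rw [h4, pencil_act]
    exact (AlgHom.map_det (aeval _) _).symm
  have hQ : rdPencil (g.act Φ).Q = linSubst g.M.1 (C (g.N.1.det ^ 2) *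
      (rdPencil Φ.Q - g.pfShift Φ * pfPencil Φ.Q - g.pfShift Φ ^ 2)) := by
    have h4 : C (1 / 4) * (C 2 * C 2) = (1 : MvPolynomial (Fin 2) K) := by
      rw [← C_mul, ← C_mul, ← C_1]
      norm_num
    rw [rdPencil, hdet, hP]
    have h5 : ∀ q d D p ρ : MvPolynomial (Fin 2) K, q * (C 2 * C 2) = 1 →
        d ^ 2 * (q * (D - p ^ 2) - ρ * p - ρ ^ 2) =
          q * (d ^ 2 * D - (d * (p + C 2 * ρ)) ^ 2) := by
      intro q d D p ρ h
      rw [h2] at h ⊢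
      linear_combination d ^ 2 * (ρ * p + ρ ^ 2) * h
    rw [rdPencil, C_pow, h5 _ _ _ _ _ h4]
    simp only [linSubst, map_mul, map_sub, map_pow, aeval_C, algebraMap_eq]
  have hμ : ((g.toTrans2 Φ).μ : K) = g.N.1.det := rfl
  have hN : (g.toTrans2 Φ).N = g.M := rfl
  simp only [Model4.toModel2, Trans2.act, rForm_toTrans2, hμ, hN, hP, hQ]

end Trans4

end

section
variable {K : Type*} [Field K]

theorem eval_smul_of_isHomogeneous_four {f : MvPolynomial (Fin 2) K} (hf : f.IsHomogeneous 4)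
    (κ : K) (z : Fin 2 → K) : eval (κ • z) f = κ ^ 4 * eval z f := by
  rw [eval_of_isHomogeneous_four hf, eval_of_isHomogeneous_four hf]
  simp only [Pi.smul_apply, smul_eq_mul]
  ring

theorem F2_isHomogeneous (Φ : Model2 K) : (F2 Φ.P Φ.Q).IsHomogeneous 4 :=
  (Φ.hP.pow 2).add (Φ.hQ.C_mul _)

theorem eval_smul_G2 (Φ : Model2 K) (κ : K) (z : Fin 2 → K) :
    eval (κ • z) (G2 Φ.P Φ.Q) = κ ^ 4 * eval z (G2 Φ.P Φ.Q) := by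
  simp only [G2, map_add, map_mul, map_pow, eval_C, eval_X, Pi.smul_apply, smul_eq_mul]
  ring

/-- The point `(T₁ : -T₂)` at which the binary quartic is evaluated. -/
def Model4.pencilPoint (Φ : Model4 K) (x : Fin 4 → K) : Fin 2 → K :=
  ![eval x (T1 Φ.Q), -eval x (T2 Φ.Q)]

theorem eval_aeval_pencilPoint (Φ : Model4 K) (x : Fin 4 → K) (f : MvPolynomial (Fin 2) K) :
    eval x (aeval ![T1 Φ.Q, -T2 Φ.Q] f) = eval (Φ.pencilPoint x) f := by
  have h : Φ.pencilPoint x = fun i => eval x ((![T1 Φ.Q, -T2 Φ.Q] : Fin 2 → _) i) := by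
    ext i; fin_cases i <;> simp [Model4.pencilPoint]
  rw [h]
  induction f using MvPolynomial.induction_on with
  | C a => simp
  | add p q hp hq => simp_all
  | mul_X p i hp => simp_all

theorem eval_F4 (Φ : Model4 K) (x : Fin 4 → K) :
    eval x (F4 Φ.Q) = eval (Φ.pencilPoint x) (F2 Φ.toModel2.P Φ.toModel2.Q) :=
  eval_aeval_pencilPoint Φ x _

theorem eval_G4 (Φ : Model4 K) (x : Fin 4 → K) :
    eval x (G4 Φ.Q) = eval (Φ.pencilPoint x) (G2 Φ.toModel2.P Φ.toModel2.Q) :=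
  eval_aeval_pencilPoint Φ x _

namespace Trans4

theorem eval_act_Q (g : Trans4 K) (Φ : Model4 K) {x x' : Fin 4 → K}
    (hx : ∀ j, x j = ∑ i, g.N.1 i j * x' i) (i : Fin 2) :
    eval x' ((g.act Φ).Q i) = ∑ j, g.M.1 i j * eval x (Φ.Q j) := by
  rw [act, eval_linSubst, ← funext hx]
  simp

theorem isPoint_act_iff (g : Trans4 K) (Φ : Model4 K)
    {x x' : Fin 4 → K} (hx : ∀ j, x j = ∑ i, g.N.1 i j * x' i) :
    (g.act Φ).IsPoint x' ↔ Φ.IsPoint x := by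
  rw [Model4.IsPoint, Model4.IsPoint, Ne, Ne, eq_zero_iff_of_eq_sum_mul g.N hx]
  simp only [g.eval_act_Q Φ hx]
  refine and_congr Iff.rfl ⟨fun h k => ?_, fun h i => by simp [h]⟩
  have hM : ((g.M⁻¹).1 * g.M.1) = 1 := by rw [← Units.val_mul, inv_mul_cancel, Units.val_one]
  have h2 : (fun j => eval x (Φ.Q j)) = 0 := by
    rw [← Matrix.one_mulVec (fun j => eval x (Φ.Q j)), ← hM, ← Matrix.mulVec_mulVec,
      show g.M.1.mulVec (fun j => eval x (Φ.Q j)) = 0 from funext h, Matrix.mulVec_zero]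
  exact congrFun h2 k

theorem dotProduct_gramMatrix_mulVec {Φ : Model4 K} {x : Fin 4 → K}
    (h : ∀ i, eval x (Φ.Q i) = 0) (i : Fin 2) :
    x ⬝ᵥ (gramMatrix (Φ.Q i)).mulVec x = 0 := by
  rw [gramMatrix_eq_hessianAt, ← two_mul_eval_of_isHomogeneous_two (Φ.hQ i), h, mul_zero]

/-- For diagonal `N` each of the three products in $\mathrm{pf}$ involves all four indices once, so
$\mathrm{pf}$ scales by `det N` exactly and $\rho=0$. -/
theorem toTrans2_isDiagonal {g : Trans4 K} (hg : g.IsDiagonal) (Φ : Model4 K) :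
    (g.toTrans2 Φ).IsDiagonal := by
  refine ⟨?_, hg.1⟩
  have hN : g.N.1 = Matrix.diagonal fun i => g.N.1 i i := (hg.2.diagonal_diag).symm
  have hdet : g.N.1.det = g.N.1 0 0 * g.N.1 1 1 * g.N.1 2 2 * g.N.1 3 3 := by
    conv_lhs => rw [hN]
    rw [Matrix.det_diagonal, Fin.prod_univ_four]
  have h : ∀ i j, (g.N.1.map C * pencil Φ.Q * (g.N.1.map C).transpose :
      Matrix (Fin 4) (Fin 4) (MvPolynomial (Fin 2) K)) i j = C (g.N.1 i i) * C (g.N.1 j j) * pencil Φ.Q i j := by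
    intro i j
    have hC : g.N.1.map C = Matrix.diagonal fun i => (C (g.N.1 i i) : MvPolynomial (Fin 2) K) := by
      conv_lhs => rw [hN]
      rw [Matrix.diagonal_map C_0]
    rw [hC, Matrix.diagonal_transpose, Matrix.mul_diagonal, Matrix.diagonal_mul]
    ring
  have hs : g.pfShift Φ = 0 := by
    rw [pfShift, pf, pfPencil, hdet]
    simp only [h, C_mul]
    ring
  ext i
  fin_cases i <;> simp [toTrans2, hs, coeff2]

variable [CharZero K]

/-- The change of `xᵀ A adj(B) A x` under a transformation. -/
theorem dotProduct_adjugate_act {A B N : Matrix (Fin 4) (Fin 4) K} (hA : A.transpose = A)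
    (hB : B.transpose = B) {x x' : Fin 4 → K} (hx : ∀ j, x j = ∑ i, N i j * x' i)
    (hxA : x ⬝ᵥ A.mulVec x = 0) (hxB : x ⬝ᵥ B.mulVec x = 0) (a b c d : K) :
    ((N * (a • A + b • B) * N.transpose).mulVec x') ⬝ᵥ
        ((N * (c • A + d • B) * N.transpose).adjugate.mulVec
          ((N * (a • A + b • B) * N.transpose).mulVec x')) =
      N.det ^ 2 * ((a * d - b * c) ^ 2 * (d * (A.mulVec x ⬝ᵥ B.adjugate.mulVec (A.mulVec x))
        + c * (B.mulVec x ⬝ᵥ A.adjugate.mulVec (B.mulVec x)))) := by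
  have hx' : N.transpose.mulVec x' = x := by
    ext j
    rw [hx]
    rfl
  rw [← Matrix.mulVec_mulVec, hx', ← Matrix.mulVec_mulVec, dotProduct_adjugate_conj,
    dotProduct_adjugate_pencil hA hB hxA hxB]

/-- By `dotProduct_adjugate_act`, $(T_1,-T_2)$ is multiplied by $(\det N)^2(\det
M)^2\,\mathrm{adj}(M^{T})$; applying $M^{T}$ yields one more $\det M$. The sign of $T_2$ is what
makes the adjugate appear. -/
theorem pencilPoint_act (g : Trans4 K) (Φ : Model4 K) {x x' : Fin 4 → K}
    (hx : ∀ j, x j = ∑ i, g.N.1 i j * x' i) (h : ∀ i, eval x (Φ.Q i) = 0) (j : Fin 2) :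
    ((g.N.1.det ^ 2 * g.M.1.det ^ 3) • Φ.pencilPoint x) j =
      ∑ i, g.M.1 i j * (g.act Φ).pencilPoint x' i := by
  have h' : ∀ i, eval x' ((g.act Φ).Q i) = 0 := fun i => by simp [g.eval_act_Q Φ hx, h]
  have q0 := dotProduct_gramMatrix_mulVec h 0
  have q1 := dotProduct_gramMatrix_mulVec h 1
  have s0 := gramMatrix_transpose (Φ.Q 0)
  have s1 := gramMatrix_transpose (Φ.Q 1)
  have e1 := eval_covT s0 s1 q0
  have e2 := eval_covT s1 s0 q1
  have e1' := eval_covT (gramMatrix_transpose _) (gramMatrix_transpose ((g.act Φ).Q 1))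
    (dotProduct_gramMatrix_mulVec h' 0)
  have e2' := eval_covT (gramMatrix_transpose _) (gramMatrix_transpose ((g.act Φ).Q 0))
    (dotProduct_gramMatrix_mulVec h' 1)
  rw [gramMatrix_act, gramMatrix_act, dotProduct_adjugate_act s0 s1 hx q0 q1,
    ← gramMatrix_act, ← gramMatrix_act] at e1' e2'
  simp only [Model4.pencilPoint, T1, T2, e1, e2, e1', e2', Fin.sum_univ_two, Pi.smul_apply,
    smul_eq_mul, Matrix.det_fin_two, Matrix.cons_val_zero, Matrix.cons_val_one]
  fin_cases j <;> simp <;> ring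

/-- The quartic is multiplied by $\mu^2=(\det N)^2$, and rescaling the point by $(\det N)^2(\det
M)^3$ contributes the fourth power of that scalar. -/
theorem eval_F4_act (g : Trans4 K) (Φ : Model4 K) {x x' : Fin 4 → K}
    (hx : ∀ j, x j = ∑ i, g.N.1 i j * x' i) (h : ∀ i, eval x (Φ.Q i) = 0) :
    eval x' (F4 (g.act Φ).Q) = g.N.1.det ^ 10 * g.M.1.det ^ 12 * eval x (F4 Φ.Q) := by
  rw [eval_F4, toModel2_act, Trans2.eval_F2_act (g.toTrans2 Φ) _ (g.pencilPoint_act Φ hx h),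
    eval_smul_of_isHomogeneous_four (F2_isHomogeneous _), ← eval_F4]
  change g.N.1.det ^ 2 * _ = _
  ring

theorem eval_G4_act (g : Trans4 K) (Φ : Model4 K) {x x' : Fin 4 → K}
    (hx : ∀ j, x j = ∑ i, g.N.1 i j * x' i) (h : ∀ i, eval x (Φ.Q i) = 0) :
    eval x' (G4 (g.act Φ).Q) = g.N.1.det ^ 12 * g.M.1.det ^ 12 *
      (g.M.1.det ^ 2 * eval x (G4 Φ.Q) -
        (g.toTrans2 Φ).shift Φ.toModel2 * eval x (F4 Φ.Q)) := by
  rw [eval_G4, toModel2_act, Trans2.eval_G2_act (g.toTrans2 Φ) _ (g.pencilPoint_act Φ hx h),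
    eval_smul_of_isHomogeneous_four (F2_isHomogeneous _), eval_smul_G2, ← eval_F4, ← eval_G4]
  change g.N.1.det ^ 4 * (g.M.1.det ^ 2 * _ - _) = _
  ring

end Trans4

end

/-! ### Degree 4: integrality of the binary quartic and of its transformation. -/

/-- The matrix of second derivatives of the base change of a quadratic form. -/
theorem gramMatrix_map {R K : Type*} [CommRing R] [Field K] (φ : R →+* K) (f : MvPolynomial (Fin 4) R) :
    gramMatrix (MvPolynomial.map φ f) = (hessianAt f 0).map φ := by
  rw [gramMatrix_eq_hessianAt, hessianAt_map]

theorem pencilMatrix_transpose {R : Type*} [CommRing R] {A B : Matrix (Fin 4) (Fin 4) R}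
    (hA : A.transpose = A) (hB : B.transpose = B) :
    (pencilMatrix A B).transpose = pencilMatrix A B := by
  ext1 i j
  rw [Matrix.transpose_apply, pencilMatrix, Matrix.of_apply, Matrix.of_apply,
    ← Matrix.transpose_apply A, ← Matrix.transpose_apply B, hA, hB]

theorem two_dvd_pencilMatrix {R : Type*} [CommRing R] {A B : Matrix (Fin 4) (Fin 4) R}
    (hA : ∀ i, 2 ∣ A i i) (hB : ∀ i, 2 ∣ B i i) (i : Fin 4) : 2 ∣ pencilMatrix A B i i := by
  have h2 : (2 : MvPolynomial (Fin 2) R) = C 2 := (map_ofNat C 2).symm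
  rw [h2]
  exact dvd_add (Dvd.dvd.mul_right (map_dvd C (hA i)) _) (Dvd.dvd.mul_right (map_dvd C (hB i)) _)

section
variable {R K : Type*} [CommRing R] [Field K] (φ : R →+* K) (Φ : Model4 R)

/-- The pencil of a model, over its ring of definition. -/
def Model4.pencil₀ : Matrix (Fin 4) (Fin 4) (MvPolynomial (Fin 2) R) :=
  pencilMatrix (hessianAt (Φ.Q 0) 0) (hessianAt (Φ.Q 1) 0)

theorem Model4.pencil₀_transpose : Φ.pencil₀.transpose = Φ.pencil₀ :=
  pencilMatrix_transpose (hessianAt_transpose _ _) (hessianAt_transpose _ _)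

theorem Model4.two_dvd_pencil₀ (i : Fin 4) : 2 ∣ Φ.pencil₀ i i :=
  two_dvd_pencilMatrix (two_dvd_hessianAt_zero _) (two_dvd_hessianAt_zero _) i

theorem Model4.pencil_map : pencil (Φ.map φ).Q = Φ.pencil₀.map (MvPolynomial.map φ) := by
  rw [pencil_eq, Model4.map, gramMatrix_map, gramMatrix_map, pencilMatrix_map]
  rfl

theorem Model4.pfPencil_map :
    pfPencil (Φ.map φ).Q = MvPolynomial.map φ (pf Φ.pencil₀) := by
  rw [← map_pf, ← Φ.pencil_map]
  rfl

theorem Model4.exists_rdPencil_map [CharZero K] :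
    ∃ w, rdPencil (Φ.map φ).Q = MvPolynomial.map φ w := by
  obtain ⟨w, hw⟩ := exists_det_eq_pf_sq_add Φ.pencil₀ Φ.pencil₀_transpose Φ.two_dvd_pencil₀
  refine ⟨w, ?_⟩
  have h : (pencil (Φ.map φ).Q).det = MvPolynomial.map φ Φ.pencil₀.det := by
    rw [Φ.pencil_map, RingHom.map_det]
    rfl
  have h4 : C (1 / 4) * 4 = (1 : MvPolynomial (Fin 2) K) := by
    rw [← map_ofNat C 4, ← C_mul, ← C_1]
    norm_num
  rw [rdPencil, h, hw, Φ.pfPencil_map, map_add, map_mul, map_pow, map_ofNat]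
  linear_combination MvPolynomial.map φ w * h4

/-- `exists_pf_conj` cancels the 2 in the denominator of $\rho$; what is left is `det N`, a unit
over $R$. -/
theorem Trans4.exists_pfShift_map [CharZero K] (g : Trans4 R) :
    ∃ w, (g.map φ).pfShift (Φ.map φ) = C ((g.map φ).N.1.det)⁻¹ * MvPolynomial.map φ w := by
  obtain ⟨w, hw⟩ := exists_pf_conj (g.N.1.map C) Φ.pencil₀ Φ.pencil₀_transpose Φ.two_dvd_pencil₀
  refine ⟨w, ?_⟩
  have hN : (g.map φ).N.1.map C = (g.N.1.map C).map
      (MvPolynomial.map φ : MvPolynomial (Fin 2) R →+* MvPolynomial (Fin 2) K) := by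
    ext1 i j
    simp [Trans4.map]
  have hconj : pf ((g.map φ).N.1.map C * pencil (Φ.map φ).Q * ((g.map φ).N.1.map C).transpose) =
      MvPolynomial.map φ (pf (g.N.1.map C * Φ.pencil₀ * (g.N.1.map C).transpose)) := by
    rw [← map_pf, Φ.pencil_map, hN, Matrix.map_mul, Matrix.map_mul, Matrix.transpose_map]
  have hdet : (g.N.1.map C).det = (C g.N.1.det : MvPolynomial (Fin 2) R) :=
    (RingHom.map_det C g.N.1).symm
  have hdet' : (g.map φ).N.1.det = φ g.N.1.det := (RingHom.map_det φ g.N.1).symm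
  have hδ := (g.map φ).det_ne_zero
  have h2 : C (1 / (2 * (g.map φ).N.1.det)) * 2 =
      (C ((g.map φ).N.1.det)⁻¹ : MvPolynomial (Fin 2) K) := by
    rw [← map_ofNat C 2, ← C_mul]
    congr 1
    field_simp
  rw [Trans4.pfShift, hconj, hw, hdet, map_add, map_mul, map_mul, map_C, map_ofNat,
    Φ.pfPencil_map, ← hdet', ← h2]
  ring

end

section
variable {K : Type*} [NormedField K] [IsUltrametricDist K] [CharZero K] {abv : AbsoluteValue K ℝ}

theorem Trans4.shift_toTrans2_mem (habv : ∀ a b : K, abv a ≤ abv b ↔ ‖a‖ ≤ ‖b‖)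
    (g₀ : Trans4 (ringOfInts K)) (Φ : Model4 (ringOfInts K)) :
    ((g₀.map (ringOfInts K).subtype).toTrans2 Φ.toField).shift Φ.toField.toModel2 ∈
      ringOfInts K := by
  have hδ : ((g₀.map (ringOfInts K).subtype).N.1.det)⁻¹ ∈ ringOfInts K := by
    rw [← abv_le_one_iff habv, map_inv₀]
    exact (inv_eq_one.2 (abv_det_map_eq_one habv g₀.N)).le
  obtain ⟨w, hw⟩ := Trans4.exists_pfShift_map (ringOfInts K).subtype Φ g₀
  obtain ⟨v, hv⟩ := Φ.exists_rdPencil_map (ringOfInts K).subtype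
  have hr : ∀ i j, coeff2 ((g₀.map (ringOfInts K).subtype).pfShift Φ.toField) i j ∈
      ringOfInts K := by
    intro i j
    rw [Model4.toField, hw, coeff2, coeff_C_mul, coeff_map]
    exact mul_mem hδ (Subtype.property _)
  refine Trans2.shift_mem _ _ _ (fun i => ?_) (fun i j => (g₀.M.1 i j).2) ?_ ?_
  · fin_cases i <;> exact hr _ _
  · intro i j
    change coeff2 (pfPencil (Φ.map (ringOfInts K).subtype).Q) i j ∈ _
    rw [Φ.pfPencil_map, coeff2_map]
    exact Subtype.property _
  · intro i j
    change coeff2 (rdPencil (Φ.map (ringOfInts K).subtype).Q) i j ∈ _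
    rw [hv, coeff2_map]
    exact Subtype.property _

/-- In the diagonal case $|\det M|=|\det N|^{-1}$, and the exponents are $10-12$ for $F_4$ and
$12-14$ for $G_4$, both $-2$. -/
theorem Model4.maxFG_act (habv : ∀ a b : K, abv a ≤ abv b ↔ ‖a‖ ≤ ‖b‖)
    (Φ : Model4 (ringOfInts K)) (g : Trans4 K)
    (hg : g.IsIntegral ∨ (IsIntegerUnit g.det ∧ g.IsDiagonal)) {x x' : Fin 4 → K}
    (hx : ∀ j, x j = ∑ i, g.N.1 i j * x' i) (h : ∀ i, eval x (Φ.toField.Q i) = 0) :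
    (g.act Φ.toField).maxFG abv x' = abv g.N.1.det ^ (-2 : ℤ) * Φ.toField.maxFG abv x := by
  rw [maxFG, maxFG, Trans4.eval_F4_act _ _ hx h, Trans4.eval_G4_act _ _ hx h]
  rcases hg with ⟨g₀, rfl⟩ | ⟨hu, hd⟩
  · have hM : abv (g₀.map (ringOfInts K).subtype).M.1.det = 1 := abv_det_map_eq_one habv g₀.M
    have hN : abv (g₀.map (ringOfInts K).subtype).N.1.det = 1 := abv_det_map_eq_one habv g₀.N
    rw [max_abv_mul_sub habv _ _ _ (Trans4.shift_toTrans2_mem habv g₀ Φ), hN, one_zpow, one_mul]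
    all_goals simp only [map_mul, map_pow, hM, hN, one_pow, mul_one]
  · have h1 := abv_eq_one_of_isIntegerUnit habv hu
    rw [Trans4.det, map_mul] at h1
    have h2 : abv g.M.1.det = (abv g.N.1.det)⁻¹ := eq_inv_of_mul_eq_one_left h1
    have h3 : abv g.N.1.det ≠ 0 := right_ne_zero_of_mul_eq_one h1
    rw [Trans2.shift_eq_zero_of_isDiagonal (Trans4.toTrans2_isDiagonal hd _),
      mul_max_of_nonneg _ _ (by positivity)]
    simp only [map_mul, map_pow, zero_mul, sub_zero, h2]
    congr 1 <;> field_simp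

end

theorem Trans4.map_act {R S : Type*} [CommRing R] [CommRing S] (φ : R →+* S) (g : Trans4 R)
    (Φ : Model4 R) : (g.act Φ).map φ = (g.map φ).act (Φ.map φ) := by
  simp [Model4.map, act, map_linSubst, Trans4.map]

theorem Model4.tamagawaDistances_eq {K : Type*} [NormedField K] [IsUltrametricDist K]
    [CharZero K] {abv : AbsoluteValue K ℝ}
    (habv : ∀ a b : K, abv a ≤ abv b ↔ ‖a‖ ≤ ‖b‖) (π : K) {Φ Φ' : Model4 (ringOfInts K)}
    (h : Φ.Equivalent Φ') :
    Φ.toField.tamagawaDistances abv π = Φ'.toField.tamagawaDistances abv π := by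
  obtain ⟨g₀, rfl⟩ := h
  have hact : (g₀.act Φ).toField = (g₀.map (ringOfInts K).subtype).act Φ.toField :=
    Trans4.map_act _ _ _
  set g := g₀.map (ringOfInts K).subtype with hg
  have hmax : ∀ x x' : Fin 4 → K, (∀ j, x j = ∑ i, g.N.1 i j * x' i) → Φ.toField.IsPoint x →
      (g.act Φ.toField).maxFG abv x' / maxCoord abv x' ^ (2 * 4) =
        Φ.toField.maxFG abv x / maxCoord abv x ^ (2 * 4) := by
    intro x x' hx hp
    rw [maxFG_act habv Φ g (Or.inl ⟨g₀, rfl⟩) hx hp.2, hg]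
    change abv (Matrix.GeneralLinearGroup.map (ringOfInts K).subtype g₀.N).1.det ^ _ * _ / _ = _
    rw [abv_det_map_eq_one habv, one_zpow, one_mul, ← maxCoord_eq_of_integral habv g₀.N x',
      funext hx]
    rfl
  rw [hact]
  ext α
  constructor
  · rintro ⟨x, hp, hα⟩
    obtain ⟨x', hx⟩ := exists_eq_sum_mul g.N x
    exact ⟨x', (g.isPoint_act_iff _ hx).2 hp, by rw [hmax x x' hx hp, hα]⟩
  · rintro ⟨x', hp, hα⟩
    have hp' := (g.isPoint_act_iff _ fun _ => rfl).1 hp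
    exact ⟨_, hp', by rw [← hmax _ x' (fun _ => rfl) hp', hα]⟩

end GenusOne

end

theorem mainTheorem4 (p : ℕ) [Fact p.Prime]
    -- `K` is a finite extension of `ℚ_p`, with its norm extending that of `ℚ_p`
    (K : Type*) [NormedField K] [NormedAlgebra ℚ_[p] K] [FiniteDimensional ℚ_[p] K]
    [IsUltrametricDist K]
    -- `abv` is the absolute value of `K` in any normalisation
    (abv : AbsoluteValue K ℝ) (habv : ∀ a b : K, abv a ≤ abv b ↔ ‖a‖ ≤ ‖b‖)
    -- `π` is a uniformiser
    (π : GenusOne.ringOfInts K) (hπ : Irreducible π) :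
    -- degree 2
    ((∀ (Φ Φ' : GenusOne.Model2 (GenusOne.ringOfInts K)) (g : GenusOne.Trans2 K),
        Φ'.toField = g.act Φ.toField →
        (g.IsIntegral ∨ (GenusOne.IsIntegerUnit g.det ∧ g.IsDiagonal)) →
        ∀ (x : Fin 2 → K) (y : K) (x' : Fin 2 → K) (y' : K),
          Φ.toField.IsPoint x y → Φ'.toField.IsPoint x' y' →
          (∀ j, x j = ∑ i, g.N.1 i j * x' i) →
          Φ'.toField.maxFG abv x' = abv g.N.1.det ^ (-2 : ℤ) * Φ.toField.maxFG abv x) ∧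
      (∀ Φ Φ' : GenusOne.Model2 (GenusOne.ringOfInts K), Φ.Equivalent Φ' →
        Φ.toField.tamagawaDistances abv (π : K) = Φ'.toField.tamagawaDistances abv (π : K))) ∧
    -- degree 3
    ((∀ (Φ Φ' : GenusOne.Model3 (GenusOne.ringOfInts K)) (g : GenusOne.Trans3 K),
        Φ'.toField = g.act Φ.toField →
        (g.IsIntegral ∨ (GenusOne.IsIntegerUnit g.det ∧ g.IsDiagonal)) →
        ∀ x x' : Fin 3 → K,
          Φ.toField.IsPoint x → Φ'.toField.IsPoint x' →
          (∀ j, x j = ∑ i, g.N.1 i j * x' i) →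
          Φ'.toField.maxFG abv x' = abv g.N.1.det ^ (-2 : ℤ) * Φ.toField.maxFG abv x) ∧
      (∀ Φ Φ' : GenusOne.Model3 (GenusOne.ringOfInts K), Φ.Equivalent Φ' →
        Φ.toField.tamagawaDistances abv (π : K) = Φ'.toField.tamagawaDistances abv (π : K))) ∧
    -- degree 4
    ((∀ (Φ Φ' : GenusOne.Model4 (GenusOne.ringOfInts K)) (g : GenusOne.Trans4 K),
        Φ'.toField = g.act Φ.toField →
        (g.IsIntegral ∨ (GenusOne.IsIntegerUnit g.det ∧ g.IsDiagonal)) →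
        ∀ x x' : Fin 4 → K,
          Φ.toField.IsPoint x → Φ'.toField.IsPoint x' →
          (∀ j, x j = ∑ i, g.N.1 i j * x' i) →
          Φ'.toField.maxFG abv x' = abv g.N.1.det ^ (-2 : ℤ) * Φ.toField.maxFG abv x) ∧
      (∀ Φ Φ' : GenusOne.Model4 (GenusOne.ringOfInts K), Φ.Equivalent Φ' →
        Φ.toField.tamagawaDistances abv (π : K) = Φ'.toField.tamagawaDistances abv (π : K))) := by
  -- Inherited from $\mathbb{Q}_p$; it justifies the divisions by 2 and 3 in the forms and in the
  -- interpolations.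
  have : CharZero K := charZero_of_injective_algebraMap (algebraMap ℚ_[p] K).injective
  refine ⟨⟨?_, fun _ _ h => GenusOne.Model2.tamagawaDistances_eq habv π h⟩,
    ⟨?_, fun _ _ h => GenusOne.Model3.tamagawaDistances_eq habv π h⟩,
    ⟨?_, fun _ _ h => GenusOne.Model4.tamagawaDistances_eq habv π h⟩⟩
  · intro Φ Φ' g hact hg x y x' y' _ _ hx
    rw [hact]
    exact Φ.maxFG_act habv g hg hx
  · intro Φ Φ' g hact hg x x' hp _ hx
    rw [hact]
    exact Φ.maxFG_act habv g hg hx hp.2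
  · intro Φ Φ' g hact hg x x' hp _ hx
    rw [hact]
    exact Φ.maxFG_act habv g hg hx hp.2
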